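/- For a positive integer $m$ let $$G(m)=\begin{cases}\lfloor m^2/12\rfloor+1 & \text{if } m\equiv 3,6,9 \pmod{12}\text{ or } m=10,\\ \lfloor m^2/12\rfloor & \text{otherwise.}\end{cases}$$ There is an absolute constant $K$ such that the following holds for all positive integers $m$ and all $n$ and $k$ with $k>G(m)$. Suppose that $k$ queens are placed on $k$ distinct squares of an $n\times n$ chessboard. Then there is a set of at most $Km$ distinct lines, each of them a row, a column or a diagonal (of either direction) of the board and each containing at least one of the queens, such that the sum of the lengths of these lines is at least $n(m+1)$. Here the length of a line is the number of squares on it, every diagonal of the board (of any length from $1$ to $n$) is allowed, and lines of different directions count as distinct (which matters only for $n=1$). -/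

import Mathlib

namespace Queens

/-- The squares of the `n × n` board, as pairs (column, row) `(x, y)` with `0 ≤ x, y < n`. -/
abbrev Square (n : ℕ) : Type := Fin n × Fin n

/-- The rows, columns and diagonals of the `n × n` board, labelled by their direction and their
position: `posDiag d` is the diagonal `y - x = d` (from lower left to upper right), and `negDiag s`
is the diagonal `x + y = s` (from upper left to lower right). Labels of diagonals that miss the
board are harmless: they denote the empty set of squares. -/
inductive Line (n : ℕ) : Type
  | row (y : Fin n)
  | col (x : Fin n)
  | posDiag (d : ℤ)
  | negDiag (s : ℤ)

/-- The square `q` lies on the given line. -/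
def Line.Contains {n : ℕ} : Line n → Square n → Prop
  | .row y, q => q.2 = y
  | .col x, q => q.1 = x
  | .posDiag d, q => ((q.2 : ℕ) : ℤ) - ((q.1 : ℕ) : ℤ) = d
  | .negDiag s, q => ((q.1 : ℕ) : ℤ) + ((q.2 : ℕ) : ℤ) = s

open Classical in
/-- The length of a line: the number of squares of the board on it. -/
noncomputable def Line.length {n : ℕ} (L : Line n) : ℕ :=
  (Finset.univ.filter fun q : Square n => L.Contains q).card

/-- `G m` is `⌊m² / 12⌋ + 1` if `m ≡ 3, 6, 9 (mod 12)` or `m = 10`, and `⌊m² / 12⌋` otherwise. -/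
def G (m : ℕ) : ℕ :=
  if m % 12 = 3 ∨ m % 12 = 6 ∨ m % 12 = 9 ∨ m = 10 then m ^ 2 / 12 + 1 else m ^ 2 / 12

end Queens

/-! Suppose the queens occupy a columns and b rows. These lines have length n each, so a + b > m is
immediate. Otherwise put N = m - a - b; diagonals of total length n(N + 1) are needed, and their
number only has to be O(m).

View each queen as an edge between its two diagonals. By Kőnig (`exists_matching_or_cover`), either
N + 1 queens have pairwise distinct diagonals in both directions, and the two diagonals through one
square have total length at least n + 1; or N diagonals cover all queens.

In the second case, peel boundary layers off the a × b grid of occupied columns and rows. A diagonal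
meets each layer at most twice, so k ≤ 2iN + (a - 2i)(b - 2i) for every i
(`card_restrict_le_of_cover`). Taking i near (a + b - N)/4 gives about m²/12. Comparison with G
leaves only cases where one such bound is sharp and a, b differ by at most 1
(`exists_sharp_layer_of_G_lt`).

Sharpness is rigid: every peeled layer is covered exactly by the diagonals, and the last peeled
layer together with its interior is a full grid. Few diagonals cover this grid, so it is
geometrically square, with equally many, c, rows and columns, c odd and N = 2c - 2
(`width_eq_height_of_cover`). The diagonals through its first and last rows have total length
roughly n(2c - 2), about n too little. If its columns are not symmetric, two further diagonals make
up the deficit (`hasDiagonals_of_asymmetric`). If they are, exact covering of the next layer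
outwards, at distance η below, forces an arithmetic progression of step η across the columns
(`exists_progression`). Hence the grid has width at most (c - 1)η while lying at distance at least η
from three sides of the board; its diagonals are then long enough (`hasDiagonals_of_margin`). -/

namespace Queens

open Finset

/-! ### Kőnig's theorem -/

/-- One half of Kőnig's theorem: in a vertex cover `A ∪ B` of minimal size, the vertices of `A` can
be matched into the complement of `B`. -/
theorem exists_matching_of_minimal_cover {α β : Type*} [DecidableEq α] [DecidableEq β]
    (E : Finset (α × β)) (A : Finset α) (B : Finset β)
    (hcov : ∀ e ∈ E, e.1 ∈ A ∨ e.2 ∈ B)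
    (hmin : ∀ (A' : Finset α) (B' : Finset β), (∀ e ∈ E, e.1 ∈ A' ∨ e.2 ∈ B') →
      A.card + B.card ≤ A'.card + B'.card) :
    ∃ f : A → β, Function.Injective f ∧ ∀ a : A, ((a : α), f a) ∈ E ∧ f a ∉ B := by
  classical
  let t : A → Finset β := fun a => (E.filter fun e => e.1 = (a : α) ∧ e.2 ∉ B).image Prod.snd
  have ht : ∀ (a : A) (b : β), b ∈ t a ↔ ((a : α), b) ∈ E ∧ b ∉ B := by
    intro a b
    simp only [t, mem_image, mem_filter]
    constructor
    · rintro ⟨⟨x, y⟩, ⟨h, rfl, h'⟩, rfl⟩; exact ⟨h, h'⟩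
    · rintro ⟨h, h'⟩; exact ⟨(a, b), ⟨h, rfl, h'⟩, rfl⟩
  have hall : ∀ s : Finset A, s.card ≤ (s.biUnion t).card := by
    intro s
    have h1 : (s.map (Function.Embedding.subtype _)).card = s.card := card_map _
    have hsub : s.map (Function.Embedding.subtype _) ⊆ A := by
      intro x hx
      obtain ⟨y, _, rfl⟩ := mem_map.1 hx
      exact y.2
    -- Exchanging `s` for its neighbours outside `B` gives another cover, so minimality is Hall's
    -- condition.
    have h2 := hmin (A \ s.map (Function.Embedding.subtype _)) (B ∪ s.biUnion t) (by
      intro e he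
      by_cases hB : e.2 ∈ B
      · exact Or.inr (mem_union_left _ hB)
      have hA : e.1 ∈ A := (hcov e he).resolve_right hB
      by_cases hs : (⟨e.1, hA⟩ : A) ∈ s
      · right
        exact mem_union_right _ (mem_biUnion.2 ⟨_, hs, (ht _ _).2 ⟨he, hB⟩⟩)
      · left
        refine mem_sdiff.2 ⟨hA, fun h => ?_⟩
        obtain ⟨y, hy, hye⟩ := mem_map.1 h
        apply hs
        have : y = ⟨e.1, hA⟩ := Subtype.ext hye
        rwa [← this])
    have h3 := card_sdiff_add_card_eq_card hsub
    have h4 := card_union_le B (s.biUnion t)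
    omega
  obtain ⟨f, hf, hft⟩ := (Finset.all_card_le_biUnion_card_iff_exists_injective t).1 hall
  exact ⟨f, hf, fun a => (ht a _).1 (hft a)⟩

/-- Kőnig's theorem for a finite bipartite graph, given by its set of edges. -/
theorem exists_matching_or_cover {α β : Type*} [DecidableEq α] [DecidableEq β]
    (E : Finset (α × β)) (N : ℕ) :
    (∃ M ⊆ E, M.card = N + 1 ∧ Set.InjOn Prod.fst (M : Set (α × β)) ∧
      Set.InjOn Prod.snd (M : Set (α × β))) ∨
    ∃ (A : Finset α) (B : Finset β), A.card + B.card ≤ N ∧ ∀ e ∈ E, e.1 ∈ A ∨ e.2 ∈ B := by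
  classical
  let p : ℕ → Prop := fun c => ∃ (A : Finset α) (B : Finset β), A.card + B.card = c ∧
    ∀ e ∈ E, e.1 ∈ A ∨ e.2 ∈ B
  have hp : ∃ c, p c := ⟨_, E.image Prod.fst, ∅, rfl, fun e he => Or.inl (mem_image_of_mem _ he)⟩
  obtain ⟨A, B, hc, hcov⟩ := Nat.find_spec hp
  have hmin : ∀ (A' : Finset α) (B' : Finset β), (∀ e ∈ E, e.1 ∈ A' ∨ e.2 ∈ B') →
      A.card + B.card ≤ A'.card + B'.card := fun A' B' h => by
    rw [hc]; exact Nat.find_min' hp ⟨A', B', rfl, h⟩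
  by_cases hN : A.card + B.card ≤ N
  · exact Or.inr ⟨A, B, hN, hcov⟩
  left
  obtain ⟨f, hf, hfE⟩ := exists_matching_of_minimal_cover E A B hcov hmin
  obtain ⟨g, hg, hgE⟩ := exists_matching_of_minimal_cover (E.image Prod.swap) B A
    (by
      intro e he
      obtain ⟨e', he', rfl⟩ := mem_image.1 he
      exact (hcov e' he').symm)
    (by
      intro A' B' h
      have := hmin B' A' fun e he => (h e.swap (mem_image_of_mem _ he)).symm
      omega)
  have hgE' : ∀ b : B, (g b, (b : β)) ∈ E := by
    intro b
    obtain ⟨e', he', h⟩ := mem_image.1 (hgE b).1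
    have : e' = (g b, (b : β)) := by rw [← Prod.swap_swap e', h]; rfl
    rwa [← this]
  -- The edges from `A` end outside `B` and those from `B` end outside `A`, so the two matchings
  -- share no vertex.
  let M : Finset (α × β) := (univ.image fun a : A => ((a : α), f a)) ∪
    univ.image fun b : B => (g b, (b : β))
  have hM : ∀ e, e ∈ M ↔ (∃ a : A, ((a : α), f a) = e) ∨ ∃ b : B, (g b, (b : β)) = e := by
    intro e; simp [M]
  have hcard : M.card = A.card + B.card := by
    rw [card_union_of_disjoint, card_image_of_injective, card_image_of_injective]
    · simp
    · intro a b h; exact Subtype.ext (Prod.ext_iff.1 h).2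
    · intro a b h; exact Subtype.ext (Prod.ext_iff.1 h).1
    · rw [disjoint_left]
      intro e he he'
      obtain ⟨a, _, rfl⟩ := mem_image.1 he
      obtain ⟨b, _, h⟩ := mem_image.1 he'
      apply (hgE b).2
      have h' : g b = (a : α) := (Prod.ext_iff.1 h).1
      rw [h']
      exact a.2
  have h1 : Set.InjOn Prod.fst (M : Set (α × β)) := by
    intro e he e' he' h
    rcases (hM e).1 he with ⟨a, rfl⟩ | ⟨b, rfl⟩ <;> rcases (hM e').1 he' with ⟨a', rfl⟩ | ⟨b', rfl⟩
    · have : a = a' := Subtype.ext h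
      rw [this]
    · exact absurd (show g b' ∈ A from (show (a : α) = g b' from h) ▸ a.2) (hgE b').2
    · exact absurd (show g b ∈ A from (show g b = (a' : α) from h) ▸ a'.2) (hgE b).2
    · have : b = b' := hg h
      rw [this]
  have h2 : Set.InjOn Prod.snd (M : Set (α × β)) := by
    intro e he e' he' h
    rcases (hM e).1 he with ⟨a, rfl⟩ | ⟨b, rfl⟩ <;> rcases (hM e').1 he' with ⟨a', rfl⟩ | ⟨b', rfl⟩
    · have : a = a' := hf h
      rw [this]
    · exact absurd (show f a ∈ B from (show f a = (b' : β) from h) ▸ b'.2) (hfE a).2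
    · exact absurd (show f a' ∈ B from (show (b : β) = f a' from h) ▸ b.2) (hfE a').2
    · have : b = b' := Subtype.ext h
      rw [this]
  have hME : M ⊆ E := by
    intro e he
    rcases (hM e).1 he with ⟨a, rfl⟩ | ⟨b, rfl⟩
    · exact (hfE a).1
    · exact hgE' b
  obtain ⟨M', hM', hc'⟩ := exists_subset_card_eq (s := M) (n := N + 1) (by omega)
  exact ⟨M', hM'.trans hME, hc', h1.mono (by exact_mod_cast hM'), h2.mono (by exact_mod_cast hM')⟩

/-! ### Diagonals and layers of a grid -/

/-- The point `q` lies on the diagonal `d`, where `inl d` is `y - x = d` and `inr s` is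
`x + y = s`. -/
def OnDiag : ℤ ⊕ ℤ → ℤ × ℤ → Prop
  | .inl d, q => q.2 - q.1 = d
  | .inr s, q => q.1 + q.2 = s

instance (d : ℤ ⊕ ℤ) (q : ℤ × ℤ) : Decidable (OnDiag d q) := by
  cases d <;> unfold OnDiag <;> infer_instance

theorem OnDiag.lt_or_lt {d : ℤ ⊕ ℤ} {q r : ℤ × ℤ} (hq : OnDiag d q) (hr : OnDiag d r)
    (h : q ≠ r) : q.1 < r.1 ∨ r.1 < q.1 := by
  apply lt_or_gt_of_ne
  intro h1
  apply h
  refine Prod.ext h1 ?_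
  cases d <;> simp only [OnDiag] at hq hr <;> omega

/-- A finite set of integers without its least and its greatest element. -/
def peel (X : Finset ℤ) : Finset ℤ := X.filter fun x => (∃ u ∈ X, u < x) ∧ ∃ v ∈ X, x < v

theorem mem_peel {X : Finset ℤ} {x : ℤ} :
    x ∈ peel X ↔ x ∈ X ∧ (∃ u ∈ X, u < x) ∧ ∃ v ∈ X, x < v := by
  simp [peel]

theorem peel_subset (X : Finset ℤ) : peel X ⊆ X := filter_subset _ _

theorem mem_peel_iff {X : Finset ℤ} {x₁ x₂ x : ℤ} (h₁ : IsLeast (X : Set ℤ) x₁)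
    (h₂ : IsGreatest (X : Set ℤ) x₂) : x ∈ peel X ↔ x ∈ X ∧ x ≠ x₁ ∧ x ≠ x₂ := by
  rw [mem_peel]
  constructor
  · rintro ⟨hx, ⟨u, hu, hux⟩, v, hv, hxv⟩
    have := h₁.2 hu
    have := h₂.2 hv
    exact ⟨hx, by omega, by omega⟩
  · rintro ⟨hx, h, h'⟩
    have := h₁.2 hx
    have := h₂.2 hx
    exact ⟨hx, ⟨x₁, h₁.1, by omega⟩, x₂, h₂.1, by omega⟩

theorem exists_isLeast {X : Finset ℤ} (h : X.Nonempty) : ∃ x, IsLeast (X : Set ℤ) x :=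
  ⟨_, X.isLeast_min' h⟩

theorem exists_isGreatest {X : Finset ℤ} (h : X.Nonempty) : ∃ x, IsGreatest (X : Set ℤ) x :=
  ⟨_, X.isGreatest_max' h⟩

theorem card_peel (X : Finset ℤ) : (peel X).card = X.card - 2 := by
  rcases X.eq_empty_or_nonempty with rfl | hX
  · simp [peel]
  obtain ⟨x₁, h₁⟩ := exists_isLeast hX
  obtain ⟨x₂, h₂⟩ := exists_isGreatest hX
  have : peel X = (X.erase x₁).erase x₂ := by
    ext x
    rw [mem_peel_iff h₁ h₂, mem_erase, mem_erase]
    tauto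
  rw [this]
  by_cases h : x₁ = x₂
  · subst h
    have h1 : X = {x₁} := by
      ext x
      rw [mem_singleton]
      constructor
      · intro hx
        exact le_antisymm (h₂.2 hx) (h₁.2 hx)
      · rintro rfl; exact h₁.1
    rw [h1]; simp
  · rw [card_erase_of_mem (mem_erase.2 ⟨Ne.symm h, h₂.1⟩), card_erase_of_mem h₁.1]
    omega

/-- The points of `S` in the grid `X × Y`. -/
def restrict (S : Finset (ℤ × ℤ)) (X Y : Finset ℤ) : Finset (ℤ × ℤ) :=
  S.filter fun q => q.1 ∈ X ∧ q.2 ∈ Y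

/-- The points of `S` on the boundary of the grid `X × Y`. -/
def frame (S : Finset (ℤ × ℤ)) (X Y : Finset ℤ) : Finset (ℤ × ℤ) :=
  (restrict S X Y).filter fun q => ¬(q.1 ∈ peel X ∧ q.2 ∈ peel Y)

theorem mem_restrict {S : Finset (ℤ × ℤ)} {X Y : Finset ℤ} {q : ℤ × ℤ} :
    q ∈ restrict S X Y ↔ q ∈ S ∧ q.1 ∈ X ∧ q.2 ∈ Y := by
  simp [restrict]

theorem mem_frame {S : Finset (ℤ × ℤ)} {X Y : Finset ℤ} {q : ℤ × ℤ} :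
    q ∈ frame S X Y ↔ q ∈ S ∧ (q.1 ∈ X ∧ q.2 ∈ Y) ∧ ¬(q.1 ∈ peel X ∧ q.2 ∈ peel Y) := by
  simp only [frame, mem_filter, mem_restrict]
  tauto

theorem mem_frame_iff {S : Finset (ℤ × ℤ)} {X Y : Finset ℤ} {x₁ x₂ y₁ y₂ : ℤ}
    (hx₁ : IsLeast (X : Set ℤ) x₁) (hx₂ : IsGreatest (X : Set ℤ) x₂)
    (hy₁ : IsLeast (Y : Set ℤ) y₁) (hy₂ : IsGreatest (Y : Set ℤ) y₂) {q : ℤ × ℤ} :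
    q ∈ frame S X Y ↔ q ∈ S ∧ (q.1 ∈ X ∧ q.2 ∈ Y) ∧
      (q.1 = x₁ ∨ q.1 = x₂ ∨ q.2 = y₁ ∨ q.2 = y₂) := by
  rw [mem_frame, mem_peel_iff hx₁ hx₂, mem_peel_iff hy₁ hy₂]
  tauto

theorem card_restrict (S : Finset (ℤ × ℤ)) (X Y : Finset ℤ) :
    (restrict S X Y).card = (frame S X Y).card + (restrict S (peel X) (peel Y)).card := by
  rw [← card_filter_add_card_filter_not (s := restrict S X Y)
    (fun q => q.1 ∈ peel X ∧ q.2 ∈ peel Y), add_comm]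
  congr 2
  ext q
  simp only [mem_filter, mem_restrict]
  constructor
  · rintro ⟨⟨h, _⟩, h'⟩; exact ⟨h, h'⟩
  · rintro ⟨h, h1, h2⟩; exact ⟨⟨h, peel_subset _ h1, peel_subset _ h2⟩, h1, h2⟩

theorem card_restrict_le (S : Finset (ℤ × ℤ)) (X Y : Finset ℤ) :
    (restrict S X Y).card ≤ X.card * Y.card := by
  rw [← card_product]
  apply card_le_card
  intro q hq
  exact mem_product.2 (mem_restrict.1 hq).2

theorem mem_of_card_restrict {S : Finset (ℤ × ℤ)} {X Y : Finset ℤ}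
    (h : (restrict S X Y).card = X.card * Y.card) {x y : ℤ} (hx : x ∈ X) (hy : y ∈ Y) :
    (x, y) ∈ S := by
  have h1 : restrict S X Y = X ×ˢ Y := by
    apply eq_of_subset_of_card_le
    · intro q hq
      exact mem_product.2 (mem_restrict.1 hq).2
    · rw [card_product, h]
  have h2 : (x, y) ∈ restrict S X Y := by rw [h1]; exact mem_product.2 ⟨hx, hy⟩
  exact (mem_restrict.1 h2).1

/-! ### Counting by layers, and the case of equality -/

/-- A diagonal meets the boundary of a grid in at most two points. -/
theorem card_frame_filter_onDiag_le (S : Finset (ℤ × ℤ)) (X Y : Finset ℤ) (d : ℤ ⊕ ℤ) :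
    ((frame S X Y).filter (OnDiag d)).card ≤ 2 := by
  by_contra! h
  have hX : X.Nonempty ∧ Y.Nonempty := by
    obtain ⟨q, hq⟩ := card_pos.1 (show 0 < ((frame S X Y).filter (OnDiag d)).card by omega)
    have := (mem_frame.1 (mem_filter.1 hq).1).2.1
    exact ⟨⟨_, this.1⟩, ⟨_, this.2⟩⟩
  obtain ⟨x₁, hx₁⟩ := exists_isLeast hX.1
  obtain ⟨x₂, hx₂⟩ := exists_isGreatest hX.1
  obtain ⟨y₁, hy₁⟩ := exists_isLeast hX.2
  obtain ⟨y₂, hy₂⟩ := exists_isGreatest hX.2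
  obtain ⟨q, hq, r, hr, s, hs, hqr, hqs, hrs⟩ := two_lt_card.1 h
  simp only [mem_filter, mem_frame_iff hx₁ hx₂ hy₁ hy₂] at hq hr hs
  obtain ⟨⟨-, ⟨hq1, hq2⟩, hq⟩, hqd⟩ := hq
  obtain ⟨⟨-, ⟨hr1, hr2⟩, hr⟩, hrd⟩ := hr
  obtain ⟨⟨-, ⟨hs1, hs2⟩, hs⟩, hsd⟩ := hs
  -- Of three points on a diagonal, the middle one has both coordinates strictly between those of
  -- the others, hence is not on the boundary.
  have a1 := hqd.lt_or_lt hrd hqr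
  have a2 := hqd.lt_or_lt hsd hqs
  have a3 := hrd.lt_or_lt hsd hrs
  have := hx₁.2 hq1
  have := hx₁.2 hr1
  have := hx₁.2 hs1
  have := hx₂.2 hq1
  have := hx₂.2 hr1
  have := hx₂.2 hs1
  have := hy₁.2 hq2
  have := hy₁.2 hr2
  have := hy₁.2 hs2
  have := hy₂.2 hq2
  have := hy₂.2 hr2
  have := hy₂.2 hs2
  cases d <;> simp only [OnDiag] at hqd hrd hsd <;> omega

/-- Double counting of a set whose points are covered by diagonals. -/
theorem card_le_sum_card_filter_onDiag {F : Finset (ℤ × ℤ)} {D : Finset (ℤ ⊕ ℤ)}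
    (hcov : ∀ q ∈ F, ∃ d ∈ D, OnDiag d q) : F.card ≤ ∑ d ∈ D, (F.filter (OnDiag d)).card := by
  have : F ⊆ D.biUnion fun d => F.filter (OnDiag d) := by
    intro q hq
    obtain ⟨d, hd, hdq⟩ := hcov q hq
    exact mem_biUnion.2 ⟨d, hd, mem_filter.2 ⟨hq, hdq⟩⟩
  exact (card_le_card this).trans card_biUnion_le

theorem card_frame_le {S : Finset (ℤ × ℤ)} {D : Finset (ℤ ⊕ ℤ)}
    (hcov : ∀ q ∈ S, ∃ d ∈ D, OnDiag d q) (X Y : Finset ℤ) :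
    (frame S X Y).card ≤ 2 * D.card := by
  calc (frame S X Y).card ≤ ∑ d ∈ D, ((frame S X Y).filter (OnDiag d)).card :=
        card_le_sum_card_filter_onDiag fun q hq => hcov q (mem_frame.1 hq).1
    _ ≤ ∑ d ∈ D, 2 := sum_le_sum fun d _ => card_frame_filter_onDiag_le S X Y d
    _ = 2 * D.card := by rw [sum_const, smul_eq_mul, mul_comm]

/-- Each of `i` peeled layers has at most `2 * D.card` points, and the remaining grid is bounded by
its area. Truncated subtraction is harmless: an exhausted grid is empty. -/
theorem card_restrict_le_of_cover {S : Finset (ℤ × ℤ)} {D : Finset (ℤ ⊕ ℤ)}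
    (hcov : ∀ q ∈ S, ∃ d ∈ D, OnDiag d q) (i : ℕ) (X Y : Finset ℤ) :
    (restrict S X Y).card ≤ 2 * i * D.card + (X.card - 2 * i) * (Y.card - 2 * i) := by
  induction i generalizing X Y with
  | zero => simpa using card_restrict_le S X Y
  | succ i ih =>
    have h1 := card_restrict S X Y
    have h2 := card_frame_le hcov X Y
    have h3 := ih (peel X) (peel Y)
    rw [card_peel, card_peel, Nat.sub_sub, Nat.sub_sub] at h3
    have h4 : 2 + 2 * i = 2 * (i + 1) := by ring
    rw [h4] at h3
    nlinarith

/-- If the bound `card_restrict_le_of_cover` is sharp, then so are all the inequalities it is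
composed of. -/
theorem card_frame_eq_of_card_restrict_eq {S : Finset (ℤ × ℤ)} {D : Finset (ℤ ⊕ ℤ)}
    (hcov : ∀ q ∈ S, ∃ d ∈ D, OnDiag d q) (i : ℕ) (X Y : Finset ℤ)
    (h : 2 * i * D.card + (X.card - 2 * i) * (Y.card - 2 * i) ≤ (restrict S X Y).card) :
    (∀ l < i, (frame S (peel^[l] X) (peel^[l] Y)).card = 2 * D.card) ∧
      (restrict S (peel^[i] X) (peel^[i] Y)).card = (X.card - 2 * i) * (Y.card - 2 * i) := by
  induction i generalizing X Y with
  | zero =>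
    refine ⟨by simp, le_antisymm ?_ ?_⟩
    · simpa using card_restrict_le S X Y
    · simpa using h
  | succ i ih =>
    have h1 := card_restrict S X Y
    have h2 := card_frame_le hcov X Y
    have h3 := card_restrict_le_of_cover hcov i (peel X) (peel Y)
    have h5 := ih (peel X) (peel Y)
    rw [card_peel, card_peel, Nat.sub_sub, Nat.sub_sub] at h3 h5
    have h4 : 2 + 2 * i = 2 * (i + 1) := by ring
    rw [h4] at h3 h5
    obtain ⟨h6, h7⟩ := h5 (by nlinarith)
    refine ⟨?_, h7⟩
    intro l hl
    cases l with
    | zero => simp only [Function.iterate_zero, id]; nlinarith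
    | succ l => exact h6 l (by omega)

theorem card_iterate_peel (X : Finset ℤ) (i : ℕ) : (peel^[i] X).card = X.card - 2 * i := by
  induction i generalizing X with
  | zero => simp
  | succ i ih => rw [Function.iterate_succ_apply, ih, card_peel]; omega

/-- A set of points is exactly covered by a set of diagonals if each diagonal contains two of the
points, and each point is on one of the diagonals only. -/
structure ExactCover (F : Finset (ℤ × ℤ)) (D : Finset (ℤ ⊕ ℤ)) : Prop where
  two : ∀ d ∈ D, (F.filter (OnDiag d)).card = 2
  cover : ∀ q ∈ F, ∃ d ∈ D, OnDiag d q
  unique : ∀ q ∈ F, ∀ d ∈ D, ∀ d' ∈ D, OnDiag d q → OnDiag d' q → d = d'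

/-- With `2 * D.card` points and at most two on each diagonal, the double count has no slack. -/
theorem exactCover_of_card_frame {S : Finset (ℤ × ℤ)} {D : Finset (ℤ ⊕ ℤ)}
    (hcov : ∀ q ∈ S, ∃ d ∈ D, OnDiag d q) {X Y : Finset ℤ}
    (h : (frame S X Y).card = 2 * D.card) : ExactCover (frame S X Y) D := by
  have hc : ∀ q ∈ frame S X Y, ∃ d ∈ D, OnDiag d q := fun q hq => hcov q (mem_frame.1 hq).1
  have hs : ∑ d ∈ D, 2 = 2 * D.card := by rw [sum_const, smul_eq_mul, mul_comm]
  refine ⟨?_, hc, ?_⟩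
  · by_contra! h'
    obtain ⟨d, hd, hne⟩ := h'
    have h1 := card_le_sum_card_filter_onDiag hc
    have h2 : ∑ d ∈ D, ((frame S X Y).filter (OnDiag d)).card < ∑ d ∈ D, 2 :=
      sum_lt_sum (fun d _ => card_frame_filter_onDiag_le S X Y d)
        ⟨d, hd, lt_of_le_of_ne (card_frame_filter_onDiag_le S X Y d) hne⟩
    omega
  · intro q hq d hd d' hd' hdq hdq'
    by_contra hne
    -- If `q` were on two diagonals, both would lose a point on removing it, leaving room for `2 *
    -- D.card - 2` points only, one too few.
    have h1 : ((frame S X Y).erase q).card ≤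
        ∑ e ∈ D, (((frame S X Y).erase q).filter (OnDiag e)).card :=
      card_le_sum_card_filter_onDiag fun r hr => hc r (mem_of_mem_erase hr)
    have key : ∀ e ∈ D, OnDiag e q →
        (((frame S X Y).erase q).filter (OnDiag e)).card ≤ 1 := by
      intro e he heq
      have h3 : ((frame S X Y).erase q).filter (OnDiag e) =
          ((frame S X Y).filter (OnDiag e)).erase q := by
        ext r; simp only [mem_filter, mem_erase]; tauto
      rw [h3, card_erase_of_mem (mem_filter.2 ⟨hq, heq⟩)]
      have := card_frame_filter_onDiag_le S X Y e
      omega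
    have hle : ∀ e, (((frame S X Y).erase q).filter (OnDiag e)).card ≤ 2 := fun e =>
      (card_le_card (filter_subset_filter _ (erase_subset _ _))).trans
        (card_frame_filter_onDiag_le S X Y e)
    rw [card_erase_of_mem hq, ← add_sum_erase _ _ hd,
      ← add_sum_erase _ _ (mem_erase.2 ⟨Ne.symm hne, hd'⟩)] at h1
    have h4 : ∑ e ∈ (D.erase d).erase d', (((frame S X Y).erase q).filter (OnDiag e)).card ≤
        ((D.erase d).erase d').card * 2 := by
      rw [← smul_eq_mul, ← sum_const]
      exact sum_le_sum fun e _ => hle e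
    rw [card_erase_of_mem (mem_erase.2 ⟨Ne.symm hne, hd'⟩), card_erase_of_mem hd] at h4
    have h5 := key d hd hdq
    have h6 := key d' hd' hdq'
    have h7 := one_lt_card.2 ⟨d, hd, d', hd', hne⟩
    omega

theorem ExactCover.exists_ne {F : Finset (ℤ × ℤ)} {D : Finset (ℤ ⊕ ℤ)} (h : ExactCover F D)
    {d : ℤ ⊕ ℤ} (hd : d ∈ D) (q : ℤ × ℤ) : ∃ r ∈ F, OnDiag d r ∧ r ≠ q := by
  obtain ⟨r, hr, hrq⟩ := exists_mem_ne (by rw [h.two d hd]; omega) q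
  exact ⟨r, (mem_filter.1 hr).1, (mem_filter.1 hr).2, hrq⟩

/-! ### Full grids covered by few diagonals -/

/-- In a grid that is at least as wide as it is high, a diagonal contains at most one point that is
in the first or last column but in neither the first nor the last row, and none if it contains a
corner. -/
theorem card_le_of_cover_of_height_le {X Y : Finset ℤ} {x₁ x₂ y₁ y₂ : ℤ}
    (hx₁ : IsLeast (X : Set ℤ) x₁) (hx₂ : IsGreatest (X : Set ℤ) x₂)
    (hy₁ : IsLeast (Y : Set ℤ) y₁) (hy₂ : IsGreatest (Y : Set ℤ) y₂)
    (hX : x₁ < x₂) (hY : y₁ < y₂) {D : Finset (ℤ ⊕ ℤ)}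
    (hcov : ∀ x ∈ X, ∀ y ∈ Y, ∃ d ∈ D, OnDiag d (x, y)) (hw : y₂ - y₁ ≤ x₂ - x₁) :
    2 * (Y.card - 2) + 2 ≤ D.card ∧ (y₂ - y₁ < x₂ - x₁ → 2 * (Y.card - 2) + 4 ≤ D.card) := by
  set L : Finset (ℤ × ℤ) := ({x₁, x₂} : Finset ℤ) ×ˢ peel Y with hL
  have hLcard : L.card = 2 * (Y.card - 2) := by
    rw [hL, card_product, card_pair hX.ne, card_peel]
  have hmem : ∀ q ∈ L, (q.1 = x₁ ∨ q.1 = x₂) ∧ q.2 ∈ Y ∧ y₁ < q.2 ∧ q.2 < y₂ := by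
    intro q hq
    obtain ⟨h1, h2⟩ := mem_product.1 hq
    rw [mem_peel_iff hy₁ hy₂] at h2
    have := hy₁.2 h2.1
    have := hy₂.2 h2.1
    refine ⟨by simpa using h1, h2.1, by omega, by omega⟩
  set Z := D.filter fun d => ∀ r ∈ L, ¬OnDiag d r with hZ
  have hone : ∀ d, (L.filter (OnDiag d)).card ≤ 1 := by
    intro d
    rw [card_le_one]
    intro q hq r hr
    by_contra hne
    rw [mem_filter] at hq hr
    have h1 := hmem q hq.1
    have h2 := hmem r hr.1
    have h3 := hq.2.lt_or_lt hr.2 hne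
    have h4 := hq.2
    have h5 := hr.2
    cases d <;> simp only [OnDiag] at h4 h5 <;> omega
  have hsum : L.card ≤ (D.filter fun d => ¬∀ r ∈ L, ¬OnDiag d r).card := by
    calc L.card ≤ ∑ d ∈ D, (L.filter (OnDiag d)).card :=
          card_le_sum_card_filter_onDiag fun q hq => by
            obtain ⟨h1, h2, -⟩ := hmem q hq
            refine hcov q.1 ?_ q.2 h2
            rcases h1 with h | h <;> rw [h]
            exacts [hx₁.1, hx₂.1]
      _ ≤ ∑ d ∈ D, if ¬∀ r ∈ L, ¬OnDiag d r then 1 else 0 := by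
          apply sum_le_sum
          intro d _
          split_ifs with h
          · rw [Nat.le_zero, card_eq_zero, filter_eq_empty_iff]
            exact fun q hq => h q hq
          · exact hone d
      _ = _ := by rw [card_filter]
  have htot := card_filter_add_card_filter_not (s := D) (fun d => ∀ r ∈ L, ¬OnDiag d r)
  rw [← hZ] at htot
  -- From a corner, a diagonal reaches the opposite side column only after climbing the full width,
  -- which is at least the height; so it misses `L`.
  have hcorner : ∀ c : ℤ × ℤ, (c.1 = x₁ ∨ c.1 = x₂) → (c.2 = y₁ ∨ c.2 = y₂) →
      ∃ d ∈ Z, OnDiag d c := by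
    intro c hc1 hc2
    obtain ⟨d, hd, hdc⟩ := hcov c.1 (by rcases hc1 with h | h <;> rw [h]; exacts [hx₁.1, hx₂.1])
      c.2 (by rcases hc2 with h | h <;> rw [h]; exacts [hy₁.1, hy₂.1])
    refine ⟨d, mem_filter.2 ⟨hd, fun r hr hdr => ?_⟩, hdc⟩
    have h1 := hmem r hr
    have h2 : c ≠ r := by rintro rfl; omega
    have h3 := OnDiag.lt_or_lt (q := c) hdc hdr h2
    cases d <;> simp only [OnDiag] at hdc hdr <;> omega
  obtain ⟨d₁, hd₁, h₁⟩ := hcorner (x₁, y₁) (Or.inl rfl) (Or.inl rfl)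
  obtain ⟨d₂, hd₂, h₂⟩ := hcorner (x₂, y₁) (Or.inr rfl) (Or.inl rfl)
  obtain ⟨d₃, hd₃, h₃⟩ := hcorner (x₁, y₂) (Or.inl rfl) (Or.inr rfl)
  obtain ⟨d₄, hd₄, h₄⟩ := hcorner (x₂, y₂) (Or.inr rfl) (Or.inr rfl)
  have hsame : ∀ (d : ℤ ⊕ ℤ) (a b c : ℤ), OnDiag d (a, c) → OnDiag d (b, c) → a = b := by
    intro d a b c h h'
    cases d <;> simp only [OnDiag] at h h' <;> omega
  have hsame' : ∀ (d : ℤ ⊕ ℤ) (a b c : ℤ), OnDiag d (a, b) → OnDiag d (a, c) → b = c := by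
    intro d a b c h h'
    cases d <;> simp only [OnDiag] at h h' <;> omega
  have h12 : d₁ ≠ d₂ := by rintro rfl; exact hX.ne (hsame _ _ _ _ h₁ h₂)
  refine ⟨?_, fun hlt => ?_⟩
  · have : ({d₁, d₂} : Finset _).card ≤ Z.card := by
      apply card_le_card
      intro d hd
      simp only [mem_insert, mem_singleton] at hd
      rcases hd with rfl | rfl <;> assumption
    rw [card_pair h12] at this
    omega
  -- In a grid strictly wider than high, not even opposite corners share a diagonal, so the corners
  -- need four.
  · have h34 : d₃ ≠ d₄ := by rintro rfl; exact hX.ne (hsame _ _ _ _ h₃ h₄)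
    have h13 : d₁ ≠ d₃ := by rintro rfl; exact hY.ne (hsame' _ _ _ _ h₁ h₃)
    have h24 : d₂ ≠ d₄ := by rintro rfl; exact hY.ne (hsame' _ _ _ _ h₂ h₄)
    have h14 : d₁ ≠ d₄ := by
      rintro rfl; cases d₁ <;> simp only [OnDiag] at h₁ h₄ <;> omega
    have h23 : d₂ ≠ d₃ := by
      rintro rfl; cases d₂ <;> simp only [OnDiag] at h₂ h₃ <;> omega
    have : ({d₁, d₂, d₃, d₄} : Finset _).card ≤ Z.card := by
      apply card_le_card
      intro d hd
      simp only [mem_insert, mem_singleton] at hd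
      rcases hd with rfl | rfl | rfl | rfl <;> assumption
    rw [card_insert_of_notMem (by simp [h12, h13, h14]),
      card_insert_of_notMem (by simp [h23, h24]), card_pair h34] at this
    omega

/-- The reflection of diagonals in the main diagonal. -/
def swapDiag : ℤ ⊕ ℤ → ℤ ⊕ ℤ := Sum.map Neg.neg id

theorem onDiag_swapDiag {d : ℤ ⊕ ℤ} {x y : ℤ} (h : OnDiag d (x, y)) :
    OnDiag (swapDiag d) (y, x) := by
  cases d <;> simp only [OnDiag, swapDiag, Sum.map_inl, Sum.map_inr, id] at h ⊢ <;> omega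

/-- A full grid that is not far from being a square, and that is covered by few diagonals, is as
wide as it is high and has as many rows as columns. -/
theorem width_eq_height_of_cover {X Y : Finset ℤ} {x₁ x₂ y₁ y₂ : ℤ}
    (hx₁ : IsLeast (X : Set ℤ) x₁) (hx₂ : IsGreatest (X : Set ℤ) x₂)
    (hy₁ : IsLeast (Y : Set ℤ) y₁) (hy₂ : IsGreatest (Y : Set ℤ) y₂)
    (hX : x₁ < x₂) (hY : y₁ < y₂) {D : Finset (ℤ ⊕ ℤ)}
    (hcov : ∀ x ∈ X, ∀ y ∈ Y, ∃ d ∈ D, OnDiag d (x, y)) (hD : D.card + 2 ≤ X.card + Y.card)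
    (hXY : X.card ≤ Y.card + 1) (hYX : Y.card ≤ X.card + 1) :
    x₂ - x₁ = y₂ - y₁ ∧ X.card = Y.card := by
  have hcov' : ∀ y ∈ Y, ∀ x ∈ X, ∃ d ∈ D.image swapDiag, OnDiag d (y, x) := by
    intro y hy x hx
    obtain ⟨d, hd, h⟩ := hcov x hx y hy
    exact ⟨_, mem_image_of_mem _ hd, onDiag_swapDiag h⟩
  have hD' : (D.image swapDiag).card ≤ D.card := card_image_le
  rcases lt_trichotomy (x₂ - x₁) (y₂ - y₁) with h | h | h
  · have := (card_le_of_cover_of_height_le hy₁ hy₂ hx₁ hx₂ hY hX hcov' h.le).2 h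
    omega
  · have h1 := (card_le_of_cover_of_height_le hx₁ hx₂ hy₁ hy₂ hX hY hcov h.ge).1
    have h2 := (card_le_of_cover_of_height_le hy₁ hy₂ hx₁ hx₂ hY hX hcov' h.le).1
    omega
  · have := (card_le_of_cover_of_height_le hx₁ hx₂ hy₁ hy₂ hX hY hcov h.le).2 h
    omega

/-! ### Total length of the diagonals of a square grid -/

/-- `S` meets at most `c` suitable diagonals of the `n × n` board of total length at least `l`. -/
def HasDiagonals (S : Finset (ℤ × ℤ)) (n : ℤ) (c : ℕ) (l : ℤ) : Prop :=
  ∃ P Q : Finset ℤ, (∀ d ∈ P, ∃ q ∈ S, q.2 - q.1 = d) ∧ (∀ s ∈ Q, ∃ q ∈ S, q.1 + q.2 = s) ∧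
    P.card + Q.card ≤ c ∧ l ≤ ∑ d ∈ P, (n - |d|) + ∑ s ∈ Q, (n - |s - (n - 1)|)

/-- The lengths of the two diagonals through a square at distance at least `e` from the border. -/
theorem length_add_length_ge {n x y e : ℤ} (hx : e ≤ x) (hx' : x + e < n) (hy : e ≤ y)
    (hy' : y + e < n) : n + 1 + 2 * e ≤ (n - |y - x|) + (n - |x + y - (n - 1)|) := by
  rcases abs_cases (y - x) with h | h <;> rcases abs_cases (x + y - (n - 1)) with h' | h' <;> omega

section Weights

variable {S : Finset (ℤ × ℤ)} {X Y : Finset ℤ} {x₁ x₂ y₁ y₂ n : ℤ}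

/-- The diagonals `y - x = d` that contain a point in the first or last row of a grid with the set
`X` of columns, first row `y₁`, and last row `y₂`. -/
def rowPosDiags (X : Finset ℤ) (y₁ y₂ : ℤ) : Finset ℤ :=
  X.image (fun x => y₁ - x) ∪ X.image (fun x => y₂ - x)

/-- The diagonals `x + y = s` that contain a point in the first or last row of a grid. -/
def rowNegDiags (X : Finset ℤ) (y₁ y₂ : ℤ) : Finset ℤ :=
  X.image (fun x => x + y₁) ∪ X.image (fun x => x + y₂)

theorem card_rowPosDiags_le : (rowPosDiags X y₁ y₂).card ≤ 2 * X.card := by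
  have := card_union_le (X.image (fun x => y₁ - x)) (X.image (fun x => y₂ - x))
  have : (X.image (fun x => y₁ - x)).card ≤ X.card := card_image_le
  have : (X.image (fun x => y₂ - x)).card ≤ X.card := card_image_le
  unfold rowPosDiags
  omega

theorem card_rowNegDiags_le : (rowNegDiags X y₁ y₂).card ≤ 2 * X.card := by
  have := card_union_le (X.image (fun x => x + y₁)) (X.image (fun x => x + y₂))
  have : (X.image (fun x => x + y₁)).card ≤ X.card := card_image_le
  have : (X.image (fun x => x + y₂)).card ≤ X.card := card_image_le
  unfold rowNegDiags
  omega

theorem mem_rowPosDiags {d : ℤ} :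
    d ∈ rowPosDiags X y₁ y₂ ↔ ∃ x ∈ X, y₁ - x = d ∨ y₂ - x = d := by
  simp only [rowPosDiags, mem_union, mem_image]
  grind

theorem mem_rowNegDiags {s : ℤ} :
    s ∈ rowNegDiags X y₁ y₂ ↔ ∃ x ∈ X, x + y₁ = s ∨ x + y₂ = s := by
  simp only [rowNegDiags, mem_union, mem_image]
  grind

theorem sum_rowPosDiags (hx₁ : IsLeast (X : Set ℤ) x₁) (hx₂ : IsGreatest (X : Set ℤ) x₂)
    (hw : x₂ - x₁ = y₂ - y₁) (f : ℤ → ℤ) :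
    ∑ d ∈ rowPosDiags X y₁ y₂, f d + f (y₁ - x₁) = ∑ x ∈ X, f (y₁ - x) + ∑ x ∈ X, f (y₂ - x) := by
  -- As width equals height, only the corner-to-corner diagonal meets both rows.
  have hinter : X.image (fun x => y₁ - x) ∩ X.image (fun x => y₂ - x) = {y₁ - x₁} := by
    ext d
    simp only [mem_inter, mem_image, mem_singleton]
    constructor
    · rintro ⟨⟨x, hx, rfl⟩, u, hu, h⟩
      have := hx₁.2 hx
      have := hx₂.2 hu
      omega
    · rintro rfl
      exact ⟨⟨x₁, hx₁.1, rfl⟩, x₂, hx₂.1, by omega⟩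
  have h := sum_union_inter (f := f) (s₁ := X.image (fun x => y₁ - x))
    (s₂ := X.image (fun x => y₂ - x))
  rw [hinter, sum_singleton, sum_image (by intro a _ b _ h; simpa using h),
    sum_image (by intro a _ b _ h; simpa using h)] at h
  exact h

theorem sum_rowNegDiags (hx₁ : IsLeast (X : Set ℤ) x₁) (hx₂ : IsGreatest (X : Set ℤ) x₂)
    (hw : x₂ - x₁ = y₂ - y₁) (f : ℤ → ℤ) :
    ∑ s ∈ rowNegDiags X y₁ y₂, f s + f (x₂ + y₁) = ∑ x ∈ X, f (x + y₁) + ∑ x ∈ X, f (x + y₂) := by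
  have hinter : X.image (fun x => x + y₁) ∩ X.image (fun x => x + y₂) = {x₂ + y₁} := by
    ext d
    simp only [mem_inter, mem_image, mem_singleton]
    constructor
    · rintro ⟨⟨x, hx, rfl⟩, u, hu, h⟩
      have := hx₂.2 hx
      have := hx₁.2 hu
      omega
    · rintro rfl
      exact ⟨⟨x₂, hx₂.1, rfl⟩, x₁, hx₁.1, by omega⟩
  have h := sum_union_inter (f := f) (s₁ := X.image (fun x => x + y₁))
    (s₂ := X.image (fun x => x + y₂))
  rw [hinter, sum_singleton, sum_image (by intro a _ b _ h; simpa using h),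
    sum_image (by intro a _ b _ h; simpa using h)] at h
  exact h

/-- The total length of the diagonals through the first and last rows of a square grid, in terms of
the distances `e x` of the points `(x, y₁)` from the border of the board. -/
theorem sum_length_rowDiags_ge (hx₁ : IsLeast (X : Set ℤ) x₁) (hx₂ : IsGreatest (X : Set ℤ) x₂)
    (hw : x₂ - x₁ = y₂ - y₁) (hy : y₁ ≤ y₂) (hx₁0 : 0 ≤ x₁) (hx₂n : x₂ < n) (hy₂n : y₂ < n)
    (e : ℤ → ℤ) (he : ∀ x ∈ X, e x ≤ x ∧ x + e x < n ∧ e x ≤ y₁ ∧ y₁ + e x < n) (hy₁0 : 0 ≤ y₁) :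
    2 * X.card * (n + 1) + 2 * ∑ x ∈ X, e x - 2 * n + |y₁ - x₁| + |x₂ + y₁ - (n - 1)| ≤
      ∑ d ∈ rowPosDiags X y₁ y₂, (n - |d|) + ∑ s ∈ rowNegDiags X y₁ y₂, (n - |s - (n - 1)|) := by
  -- The two corner-to-corner diagonals occur in both rows; subtracting them once gives `-2 * n` and
  -- the absolute values in the bound.
  have h1 := sum_rowPosDiags hx₁ hx₂ hw fun d => n - |d|
  have h2 := sum_rowNegDiags hx₁ hx₂ hw fun s => n - |s - (n - 1)|
  have h3 : ∑ x ∈ X, (n + 1 + 2 * e x) ≤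
      ∑ x ∈ X, (n - |y₁ - x|) + ∑ x ∈ X, (n - |x + y₁ - (n - 1)|) := by
    rw [← sum_add_distrib]
    apply sum_le_sum
    intro x hx
    obtain ⟨a, b, c, d⟩ := he x hx
    exact length_add_length_ge a b c d
  have h4 : ∑ x ∈ X, (n + 1) ≤
      ∑ x ∈ X, (n - |y₂ - x|) + ∑ x ∈ X, (n - |x + y₂ - (n - 1)|) := by
    rw [← sum_add_distrib]
    apply sum_le_sum
    intro x hx
    have := hx₁.2 hx
    have := hx₂.2 hx
    have := length_add_length_ge (n := n) (x := x) (y := y₂) (e := 0) (by omega) (by omega)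
      (by omega) (by omega)
    omega
  rw [sum_add_distrib, ← mul_sum] at h3
  simp only [sum_const, nsmul_eq_mul] at h3 h4
  linarith

/-- If the set of columns of a full square grid is not symmetric, then its diagonals are long. -/
theorem hasDiagonals_of_asymmetric (hx₁ : IsLeast (X : Set ℤ) x₁)
    (hx₂ : IsGreatest (X : Set ℤ) x₂)
    (hy₁ : IsLeast (Y : Set ℤ) y₁) (hy₂ : IsGreatest (Y : Set ℤ) y₂)
    (hw : x₂ - x₁ = y₂ - y₁) (hS : ∀ x ∈ X, ∀ y ∈ Y, (x, y) ∈ S)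
    (hx₁0 : 0 ≤ x₁) (hx₂n : x₂ < n) (hy₁0 : 0 ≤ y₁) (hy₂n : y₂ < n)
    {x : ℤ} (hx : x ∈ X) (hx' : x₁ + x₂ - x ∉ X)
    (h : y₁ + (x - x₁) ∈ Y ∨ y₁ + (x₂ - x) ∈ Y) :
    HasDiagonals S n (4 * X.card + 2) (n * (2 * X.card - 1)) := by
  have hlt₁ : x₁ < x := lt_of_le_of_ne (hx₁.2 hx) (by
    rintro rfl; exact hx' (by simpa using hx₂.1))
  have hlt₂ : x < x₂ := lt_of_le_of_ne (hx₂.2 hx) (by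
    rintro rfl; exact hx' (by simpa using hx₁.1))
  have hx'' : ∀ u ∈ X, x₁ ≤ u ∧ u ≤ x₂ ∧ u ≠ x₁ + x₂ - x := fun u hu =>
    ⟨hx₁.2 hu, hx₂.2 hu, by rintro rfl; exact hx' hu⟩
  have hsum := sum_length_rowDiags_ge (n := n) hx₁ hx₂ hw (by omega) hx₁0 hx₂n hy₂n (fun _ => 0)
    (fun u hu => by have := hx'' u hu; omega) hy₁0
  rw [sum_const_zero] at hsum
  have hP : ∀ d ∈ rowPosDiags X y₁ y₂, ∃ q ∈ S, q.2 - q.1 = d := by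
    intro d hd
    obtain ⟨u, hu, h | h⟩ := mem_rowPosDiags.1 hd
    · exact ⟨_, hS u hu _ hy₁.1, h⟩
    · exact ⟨_, hS u hu _ hy₂.1, h⟩
  have hQ : ∀ d ∈ rowNegDiags X y₁ y₂, ∃ q ∈ S, q.1 + q.2 = d := by
    intro d hd
    obtain ⟨u, hu, h | h⟩ := mem_rowNegDiags.1 hd
    · exact ⟨_, hS u hu _ hy₁.1, h⟩
    · exact ⟨_, hS u hu _ hy₂.1, h⟩
  have hPc := card_rowPosDiags_le (X := X) (y₁ := y₁) (y₂ := y₂)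
  have hQc := card_rowNegDiags_le (X := X) (y₁ := y₁) (y₂ := y₂)
  -- Through the ends of the row given by `h` pass two parallel diagonals which, within the width of
  -- the grid, meet the first or last row only at the missing column `x₁ + x₂ - x`. Hence both are
  -- new.
  rcases h with hy | hy
  · have n1 : y₁ + (x - x₁) - x₂ ∉ rowPosDiags X y₁ y₂ := by
      rw [mem_rowPosDiags]
      rintro ⟨u, hu, h⟩
      have := hx'' u hu
      omega
    have n2 : y₁ + (x - x₁) - x₁ ∉ insert (y₁ + (x - x₁) - x₂) (rowPosDiags X y₁ y₂) := by
      rw [mem_insert, mem_rowPosDiags]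
      rintro (h | ⟨u, hu, h⟩)
      · omega
      · have := hx'' u hu
        omega
    refine ⟨insert (y₁ + (x - x₁) - x₁) (insert (y₁ + (x - x₁) - x₂) (rowPosDiags X y₁ y₂)),
      rowNegDiags X y₁ y₂, ?_, hQ, ?_, ?_⟩
    · intro d hd
      simp only [mem_insert] at hd
      rcases hd with rfl | rfl | hd
      · exact ⟨_, hS _ hx₁.1 _ hy, rfl⟩
      · exact ⟨_, hS _ hx₂.1 _ hy, rfl⟩
      · exact hP d hd
    · rw [card_insert_of_notMem n2, card_insert_of_notMem n1]
      omega
    · rw [sum_insert n2, sum_insert n1]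
      have : |y₁ + (x - x₁) - x₁| + |y₁ + (x - x₁) - x₂| ≤
          n + |y₁ - x₁| + |x₂ + y₁ - (n - 1)| := by
        rcases abs_cases (y₁ + (x - x₁) - x₁) with h | h <;>
        rcases abs_cases (y₁ + (x - x₁) - x₂) with h | h <;>
        rcases abs_cases (y₁ - x₁) with h | h <;>
        have := abs_nonneg (x₂ + y₁ - (n - 1)) <;> omega
      nlinarith
  · have n1 : x₂ + (y₁ + (x₂ - x)) ∉ rowNegDiags X y₁ y₂ := by
      rw [mem_rowNegDiags]
      rintro ⟨u, hu, h⟩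
      have := hx'' u hu
      omega
    have n2 : x₁ + (y₁ + (x₂ - x)) ∉ insert (x₂ + (y₁ + (x₂ - x))) (rowNegDiags X y₁ y₂) := by
      rw [mem_insert, mem_rowNegDiags]
      rintro (h | ⟨u, hu, h⟩)
      · omega
      · have := hx'' u hu
        omega
    refine ⟨rowPosDiags X y₁ y₂,
      insert (x₁ + (y₁ + (x₂ - x))) (insert (x₂ + (y₁ + (x₂ - x))) (rowNegDiags X y₁ y₂)),
      hP, ?_, ?_, ?_⟩
    · intro d hd
      simp only [mem_insert] at hd
      rcases hd with rfl | rfl | hd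
      · exact ⟨_, hS _ hx₁.1 _ hy, rfl⟩
      · exact ⟨_, hS _ hx₂.1 _ hy, rfl⟩
      · exact hQ d hd
    · rw [card_insert_of_notMem n2, card_insert_of_notMem n1]
      omega
    · rw [sum_insert n2, sum_insert n1]
      have : |x₁ + (y₁ + (x₂ - x)) - (n - 1)| + |x₂ + (y₁ + (x₂ - x)) - (n - 1)| ≤
          n + |y₁ - x₁| + |x₂ + y₁ - (n - 1)| := by
        rcases abs_cases (x₁ + (y₁ + (x₂ - x)) - (n - 1)) with h | h <;>
        rcases abs_cases (x₂ + (y₁ + (x₂ - x)) - (n - 1)) with h | h <;>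
        rcases abs_cases (x₂ + y₁ - (n - 1)) with h | h <;>
        have := abs_nonneg (y₁ - x₁) <;> omega
      nlinarith

/-- If the distance of a full square grid from the border of the board is not small compared to the
size of the grid, then its diagonals are long. -/
theorem hasDiagonals_of_margin (hx₁ : IsLeast (X : Set ℤ) x₁)
    (hx₂ : IsGreatest (X : Set ℤ) x₂)
    (hy₁ : IsLeast (Y : Set ℤ) y₁) (hy₂ : IsGreatest (Y : Set ℤ) y₂)
    (hw : x₂ - x₁ = y₂ - y₁) (hS : ∀ x ∈ X, ∀ y ∈ Y, (x, y) ∈ S)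
    {η : ℤ} (hη : 0 < η) (hηw : η ≤ x₂ - x₁) (hx₁0 : η ≤ x₁) (hx₂n : x₂ + η < n) (hy₁0 : η ≤ y₁)
    (hy₂n : y₂ < n) (hwη : x₂ - x₁ ≤ (X.card - 1) * η) :
    HasDiagonals S n (4 * X.card + 2) (n * (2 * X.card - 1)) := by
  have hPc := card_rowPosDiags_le (X := X) (y₁ := y₁) (y₂ := y₂)
  have hQc := card_rowNegDiags_le (X := X) (y₁ := y₁) (y₂ := y₂)
  refine ⟨rowPosDiags X y₁ y₂, rowNegDiags X y₁ y₂, ?_, ?_, by omega, ?_⟩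
  · intro d hd
    obtain ⟨u, hu, h | h⟩ := mem_rowPosDiags.1 hd
    · exact ⟨_, hS u hu _ hy₁.1, h⟩
    · exact ⟨_, hS u hu _ hy₂.1, h⟩
  · intro d hd
    obtain ⟨u, hu, h | h⟩ := mem_rowNegDiags.1 hd
    · exact ⟨_, hS u hu _ hy₁.1, h⟩
    · exact ⟨_, hS u hu _ hy₂.1, h⟩
  -- All points of the first row get margin `η`, except one corner, whose exact margin `e₀` combines
  -- with the absolute values in `h2` below.
  set e₀ : ℤ := min (min x₁ (n - 1 - x₁)) (min y₁ (n - 1 - y₁)) with he₀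
  have hsum := sum_length_rowDiags_ge (n := n) hx₁ hx₂ hw (by omega) (by omega) (by omega) hy₂n
    (fun u => if u = x₁ then e₀ else η)
    (fun u hu => by
      have := hx₁.2 hu
      have := hx₂.2 hu
      by_cases h : u = x₁ <;> simp only [h, if_true, if_false] <;> omega) (by omega)
  rw [← add_sum_erase _ _ hx₁.1, if_pos rfl] at hsum
  have h1 : ∑ u ∈ X.erase x₁, (if u = x₁ then e₀ else η) = (X.card - 1) * η := by
    have : ∀ u ∈ X.erase x₁, (if u = x₁ then e₀ else η) = η := fun u hu =>
      if_neg (ne_of_mem_erase hu)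
    rw [sum_congr rfl this, sum_const, card_erase_of_mem hx₁.1, nsmul_eq_mul,
      Nat.cast_sub (card_pos.2 ⟨x₁, hx₁.1⟩), Nat.cast_one]
  rw [h1] at hsum
  have hc : 1 ≤ (X.card : ℤ) := by exact_mod_cast card_pos.2 ⟨x₁, hx₁.1⟩
  have h2 : n - 1 - (x₂ - x₁) ≤ 2 * e₀ + |y₁ - x₁| + |x₂ + y₁ - (n - 1)| := by
    rcases abs_cases (y₁ - x₁) with h | h <;>
    rcases abs_cases (x₂ + y₁ - (n - 1)) with h' | h' <;> omega
  nlinarith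

end Weights

/-! ### Displacements by ±η -/

/-- An injective map of a finite set of integers to itself with displacements `±η` exists only if
the set has an even number of elements. -/
theorem even_card_of_displacement {C : Finset ℤ} {g : ℤ → ℤ} {η : ℤ} (hη : 0 < η)
    (hg : ∀ x ∈ C, g x ∈ C) (hinj : Set.InjOn g (C : Set ℤ))
    (hd : ∀ x ∈ C, g x = x - η ∨ g x = x + η) : Even C.card := by
  have himage : C.image g = C := by
    apply eq_of_subset_of_card_le
    · intro y hy
      obtain ⟨x, hx, rfl⟩ := mem_image.1 hy
      exact hg x hx
    · rw [card_image_of_injOn hinj]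
  -- `g` permutes `C`, so the displacements sum to zero: `+η` and `-η` occur equally often.
  have hsum : ∑ x ∈ C, g x = ∑ x ∈ C, x := by
    conv_rhs => rw [← himage]
    rw [sum_image hinj]
  have h1 : ∑ x ∈ C, (if g x = x + η then η else -η) = 0 := by
    have : ∀ x ∈ C, (if g x = x + η then η else -η) = g x - x := by
      intro x hx
      split_ifs with h
      · rw [h]; ring
      · rw [(hd x hx).resolve_right h]; ring
    rw [sum_congr rfl this, sum_sub_distrib, hsum, sub_self]
  rw [sum_ite, sum_const, sum_const, nsmul_eq_mul, nsmul_eq_mul] at h1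
  have h2 := card_filter_add_card_filter_not (s := C) (fun x => g x = x + η)
  have h3 : ((C.filter fun x => g x = x + η).card : ℤ) =
      (C.filter fun x => ¬g x = x + η).card := by
    apply mul_right_cancel₀ hη.ne'
    linarith
  exact ⟨(C.filter fun x => g x = x + η).card, by omega⟩

/-- A finite set of odd size that is symmetric about `c / 2` contains `c / 2`. -/
theorem exists_center {X : Finset ℤ} {c : ℤ} (hsymm : ∀ x ∈ X, c - x ∈ X) (hodd : Odd X.card) :
    ∃ x ∈ X, 2 * x = c := by
  by_contra! h
  have h1 : ∑ x ∈ X, (1 : ZMod 2) = 0 := by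
    refine sum_involution (fun x _ => c - x) (fun _ _ => by decide) (fun x hx _ hfix => ?_)
      (fun x hx => hsymm x hx) (fun x _ => by ring)
    exact h x hx (by linarith)
  rw [sum_const, nsmul_one, ZMod.natCast_eq_zero_iff_even] at h1
  exact (Nat.not_even_iff_odd.2 hodd) h1

/-- A symmetric set of integers of odd size, the inner points of which are injectively displaced by
`±η`, contains an arithmetic progression with difference `η` from end to end. -/
theorem exists_progression {X : Finset ℤ} {x₁ x₂ c η : ℤ} {g : ℤ → ℤ} (hη : 0 < η)
    (hx₁ : IsLeast (X : Set ℤ) x₁) (hsymm : ∀ x ∈ X, x₁ + x₂ - x ∈ X)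
    (hc : c ∈ X) (hc2 : 2 * c = x₁ + x₂)
    (hg : ∀ x ∈ X, x ≠ x₁ → x ≠ x₂ → g x ∈ X) (hinj : Set.InjOn g (X : Set ℤ))
    (hd : ∀ x ∈ X, g x = x - η ∨ g x = x + η) :
    ∃ l : ℕ, x₁ = c - l * η ∧ ∀ i ≤ l, c - i * η ∈ X := by
  by_contra! hne
  have key : ∀ l : ℕ, ∀ i ≤ l, c - i * η ∈ X := by
    intro l
    induction l with
    | zero => intro i hi; rw [Nat.le_zero.1 hi]; simpa using hc
    | succ l ih =>
      have hx : ∀ i ≤ l, c - i * η ≠ x₁ := by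
        intro i hi h
        obtain ⟨j, hj, hj'⟩ := hne i h.symm
        exact hj' (ih j (hj.trans hi))
      by_contra! hnot
      obtain ⟨i, hi, hiX⟩ := hnot
      have hil : i = l + 1 := by
        by_contra hil
        exact hiX (ih i (by omega))
      subst hil
      have hIcc : ∀ i ∈ Icc (-(l : ℤ)) l, c + i * η ∈ X ∧ c + i * η ≠ x₁ ∧ c + i * η ≠ x₂ := by
        intro i hi
        rw [mem_Icc] at hi
        have h1 := ih i.natAbs (by omega)
        have h2 := hx i.natAbs (by omega)
        have h3 := hsymm _ h1
        rcases Int.natAbs_eq i with h | h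
        · have e : c + i * η = x₁ + x₂ - (c - (i.natAbs : ℤ) * η) := by
            rw [← h, ← hc2]; ring
          have e' : (i.natAbs : ℤ) * η = i * η := by rw [← h]
          rw [e]
          refine ⟨h3, ?_, ?_⟩
          · intro h4
            have h5 := hx₁.2 h1
            have h6 : (0 : ℤ) ≤ i.natAbs * η := by positivity
            apply h2
            linarith
          · intro h4
            apply h2
            linarith
        · have e : c + i * η = c - (i.natAbs : ℤ) * η := by
            have : (i.natAbs : ℤ) = -i := by omega
            rw [this]; ring
          rw [e]
          refine ⟨h1, h2, ?_⟩
          intro h4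
          have h5 := hx₁.2 h3
          have h7 := hx₁.2 hc
          have h6 : (0 : ℤ) ≤ i.natAbs * η := by positivity
          apply h2
          linarith
      have hout : ∀ i : ℤ, i = l + 1 ∨ i = -(l + 1) → c + i * η ∉ X := by
        rintro i (rfl | rfl) h
        · apply hiX
          have := hsymm _ h
          rw [← hc2] at this
          convert this using 1
          push_cast; ring
        · apply hiX
          convert h using 1
          push_cast; ring
      have hCinj : Function.Injective fun i : ℤ => c + i * η := by
        intro i j h
        exact mul_right_cancel₀ hη.ne' (add_left_cancel h)
      -- If the progression stopped after `l` steps on either side of `c`, `g` would map this block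
      -- of `2 * l + 1` points into itself, against parity.
      have heven := even_card_of_displacement (C := (Icc (-(l : ℤ)) l).image fun i => c + i * η)
        (g := g) hη ?_ ?_ ?_
      · rw [card_image_of_injective _ hCinj, Int.card_Icc] at heven
        obtain ⟨k, hk⟩ := heven
        omega
      · intro x hx
        obtain ⟨i, hi, rfl⟩ := mem_image.1 hx
        obtain ⟨h1, h2, h3⟩ := hIcc i hi
        have h4 := hg _ h1 h2 h3
        rw [mem_Icc] at hi
        obtain ⟨j, hj, hij⟩ : ∃ j, g (c + i * η) = c + j * η ∧ (j = i - 1 ∨ j = i + 1) := by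
          rcases hd _ h1 with h | h
          · exact ⟨i - 1, by rw [h]; ring, Or.inl rfl⟩
          · exact ⟨i + 1, by rw [h]; ring, Or.inr rfl⟩
        rw [hj] at h4 ⊢
        refine mem_image.2 ⟨j, mem_Icc.2 ?_, rfl⟩
        have n1 : j ≠ l + 1 := fun h => hout j (Or.inl h) h4
        have n2 : j ≠ -(l + 1) := fun h => hout j (Or.inr h) h4
        omega
      · refine hinj.mono ?_
        intro x hx
        obtain ⟨i, hi, rfl⟩ := mem_image.1 (mem_coe.1 hx)
        exact (hIcc i hi).1
      · intro x hx
        obtain ⟨i, hi, rfl⟩ := mem_image.1 hx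
        exact hd _ (hIcc i hi).1
  -- After `c - x₁ + 1` steps of size at least 1 the progression would have passed the minimum `x₁`.
  have h1 := hx₁.2 (key (c - x₁ + 1).toNat _ le_rfl)
  have h2 := hx₁.2 hc
  rw [Int.toNat_of_nonneg (by omega)] at h1
  nlinarith

/-! ### Two consecutive exactly covered layers -/

section Outer

variable {S : Finset (ℤ × ℤ)} {X Y : Finset ℤ} {D : Finset (ℤ ⊕ ℤ)}
  {x₀ x₁ x₂ x₃ y₀ y₁ y₂ y₃ n : ℤ}

theorem eq_of_mem_of_lt_peel (hx₀ : IsLeast (X : Set ℤ) x₀) (hx₁ : IsLeast (peel X : Set ℤ) x₁)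
    {x : ℤ} (hx : x ∈ X) (h : x < x₁) : x = x₀ := by
  by_contra hne
  have h1 : x ∈ peel X := by
    refine mem_peel.2 ⟨hx, ⟨x₀, hx₀.1, lt_of_le_of_ne (hx₀.2 hx) (Ne.symm hne)⟩,
      x₁, peel_subset _ hx₁.1, h⟩
  have := hx₁.2 h1
  omega

theorem eq_of_mem_of_peel_lt (hx₃ : IsGreatest (X : Set ℤ) x₃)
    (hx₂ : IsGreatest (peel X : Set ℤ) x₂) {x : ℤ} (hx : x ∈ X) (h : x₂ < x) : x = x₃ := by
  by_contra hne
  have h1 : x ∈ peel X := by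
    refine mem_peel.2 ⟨hx, ⟨x₂, peel_subset _ hx₂.1, h⟩, x₃, hx₃.1,
      lt_of_le_of_ne (hx₃.2 hx) hne⟩
  have := hx₂.2 h1
  omega

theorem peel_bounds (hx₀ : IsLeast (X : Set ℤ) x₀) (hx₃ : IsGreatest (X : Set ℤ) x₃)
    {x : ℤ} (hx : x ∈ peel X) : x₀ < x ∧ x < x₃ := by
  obtain ⟨_, ⟨u, hu, hux⟩, v, hv, hxv⟩ := mem_peel.1 hx
  have := hx₀.2 hu
  have := hx₃.2 hv
  omega

/-- A diagonal of the cover through a point in the first row of the inner grid meets the first row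
of the outer grid. -/
theorem exists_mem_outer_row (hx₀ : IsLeast (X : Set ℤ) x₀) (hx₃ : IsGreatest (X : Set ℤ) x₃)
    (hy₀ : IsLeast (Y : Set ℤ) y₀) (hy₃ : IsGreatest (Y : Set ℤ) y₃)
    (hy₁ : IsLeast (peel Y : Set ℤ) y₁) (hout : ExactCover (frame S X Y) D)
    {x : ℤ} (hx : x ∈ peel X) {d : ℤ ⊕ ℤ} (hd : d ∈ D) (hdx : OnDiag d (x, y₁)) :
    ∃ u, (u = x - (y₁ - y₀) ∨ u = x + (y₁ - y₀)) ∧ (u, y₀) ∈ frame S X Y ∧ OnDiag d (u, y₀) := by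
  obtain ⟨r, s, hrs, h⟩ := card_eq_two.1 (hout.two d hd)
  have hr : r ∈ (frame S X Y).filter (OnDiag d) := by rw [h]; simp
  have hs : s ∈ (frame S X Y).filter (OnDiag d) := by rw [h]; simp
  obtain ⟨hrF, hrd⟩ := mem_filter.1 hr
  obtain ⟨hsF, hsd⟩ := mem_filter.1 hs
  have hr' := (mem_frame_iff hx₀ hx₃ hy₀ hy₃).1 hrF
  have hs' := (mem_frame_iff hx₀ hx₃ hy₀ hy₃).1 hsF
  have hxb := peel_bounds hx₀ hx₃ hx
  have hyb := peel_bounds hy₀ hy₃ hy₁.1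
  have r1 := hx₀.2 hr'.2.1.1
  have r2 := hx₃.2 hr'.2.1.1
  have r3 := hy₀.2 hr'.2.1.2
  have r4 := hy₃.2 hr'.2.1.2
  have s1 := hx₀.2 hs'.2.1.1
  have s2 := hx₃.2 hs'.2.1.1
  have s3 := hy₀.2 hs'.2.1.2
  have s4 := hy₃.2 hs'.2.1.2
  -- Going up from `(x, y₁)`, the diagonal meets the outer boundary at most once, so one of its two
  -- outer points lies below.
  have hlow : r.2 < y₁ ∨ s.2 < y₁ := by
    have h1 := hrd.lt_or_lt hsd hrs
    have h2 := hr'.2.2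
    have h3 := hs'.2.2
    clear hr hs h hrF hsF hr' hs' hd hx₀ hx₃ hy₀ hy₃ hy₁ hout hx
    cases d <;> simp only [OnDiag] at hrd hsd hdx <;> omega
  have key : ∀ q ∈ frame S X Y, OnDiag d q → q.2 < y₁ →
      ∃ u, (u = x - (y₁ - y₀) ∨ u = x + (y₁ - y₀)) ∧ (u, y₀) ∈ frame S X Y ∧
        OnDiag d (u, y₀) := by
    intro q hq hqd hlt
    have h1 := eq_of_mem_of_lt_peel hy₀ hy₁ (mem_frame.1 hq).2.1.2 hlt
    have h2 : q = (q.1, y₀) := Prod.ext rfl h1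
    refine ⟨q.1, ?_, h2 ▸ hq, h2 ▸ hqd⟩
    cases d <;> simp only [OnDiag] at hqd hdx <;> omega
  rcases hlow with h | h
  exacts [key r hrF hrd h, key s hsF hsd h]

/-- A full square grid with an odd number of columns that is exactly covered together with the next
layer of points around it has long diagonals. -/
theorem hasDiagonals_of_exactCover (hx₀ : IsLeast (X : Set ℤ) x₀)
    (hx₃ : IsGreatest (X : Set ℤ) x₃)
    (hy₀ : IsLeast (Y : Set ℤ) y₀) (hy₃ : IsGreatest (Y : Set ℤ) y₃)
    (hx₁ : IsLeast (peel X : Set ℤ) x₁) (hx₂ : IsGreatest (peel X : Set ℤ) x₂)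
    (hy₁ : IsLeast (peel Y : Set ℤ) y₁) (hy₂ : IsGreatest (peel Y : Set ℤ) y₂)
    (hlt : x₁ < x₂) (hw : x₂ - x₁ = y₂ - y₁) (hS : ∀ x ∈ peel X, ∀ y ∈ peel Y, (x, y) ∈ S)
    (hodd : Odd (peel X).card)
    (hin : ExactCover (frame S (peel X) (peel Y)) D) (hout : ExactCover (frame S X Y) D)
    (hx₀0 : 0 ≤ x₀) (hx₃n : x₃ < n) (hy₀0 : 0 ≤ y₀) (hy₃n : y₃ < n) :
    HasDiagonals S n (4 * (peel X).card + 2) (n * (2 * (peel X).card - 1)) := by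
  have b1 := peel_bounds hx₀ hx₃ hx₁.1
  have b2 := peel_bounds hx₀ hx₃ hx₂.1
  have b3 := peel_bounds hy₀ hy₃ hy₁.1
  have b4 := peel_bounds hy₀ hy₃ hy₂.1
  have hbot : ∀ x ∈ peel X, (x, y₁) ∈ frame S (peel X) (peel Y) := fun x hx =>
    (mem_frame_iff hx₁ hx₂ hy₁ hy₂).2 ⟨hS x hx _ hy₁.1, ⟨hx, hy₁.1⟩, by simp⟩
  -- the inner grid is symmetric
  by_cases hsymm : ∀ x ∈ peel X, x₁ + x₂ - x ∈ peel X
  swap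
  · push Not at hsymm
    obtain ⟨x, hx, hx'⟩ := hsymm
    refine hasDiagonals_of_asymmetric hx₁ hx₂ hy₁ hy₂ hw hS (by omega) (by omega) (by omega)
      (by omega) hx hx' ?_
    -- As the grid is square and `x` is an inner column, the second boundary point of this diagonal
    -- is on a side column; its row is the one required.
    obtain ⟨d, hd, hdx⟩ := hin.cover _ (hbot x hx)
    obtain ⟨r, hr, hdr, hne⟩ := hin.exists_ne hd (x, y₁)
    obtain ⟨-, ⟨hr1, hr2⟩, h⟩ := (mem_frame_iff hx₁ hx₂ hy₁ hy₂).1 hr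
    have := hdr.lt_or_lt hdx hne
    have := hx₁.2 hr1
    have := hx₂.2 hr1
    have := hy₁.2 hr2
    have := hy₂.2 hr2
    have hxl : x ≠ x₁ := by rintro rfl; exact hx' (by simpa using hx₂.1)
    have hxr : x ≠ x₂ := by rintro rfl; exact hx' (by simpa using hx₁.1)
    have := hx₁.2 hx
    have := hx₂.2 hx
    have hd2 : r.2 = y₁ + (x - x₁) ∨ r.2 = y₁ + (x₂ - x) := by
      cases d <;> simp only [OnDiag] at hdr hdx <;> omega
    rcases hd2 with e | e
    · left; rwa [← e]
    · right; rwa [← e]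
  set η := y₁ - y₀ with hη
  have hηpos : 0 < η := by omega
  have hex : ∀ x, ∃ u, x ∈ peel X → (u = x - η ∨ u = x + η) ∧ (u, y₀) ∈ frame S X Y ∧
      ∃ d ∈ D, OnDiag d (x, y₁) ∧ OnDiag d (u, y₀) := by
    intro x
    by_cases hx : x ∈ peel X
    · obtain ⟨d, hd, hdx⟩ := hin.cover _ (hbot x hx)
      obtain ⟨u, h1, h2, h3⟩ := exists_mem_outer_row hx₀ hx₃ hy₀ hy₃ hy₁ hout hx hd hdx
      exact ⟨u, fun _ => ⟨h1, h2, d, hd, hdx, h3⟩⟩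
    · exact ⟨0, fun h => absurd h hx⟩
  choose g hg using hex
  have hgX : ∀ x ∈ peel X, g x ∈ X := fun x hx => (mem_frame.1 (hg x hx).2.1).2.1.1
  have hinj : Set.InjOn g (peel X : Set ℤ) := by
    intro x hx x' hx' h
    obtain ⟨-, h1, d, hd, hdx, hdu⟩ := hg x hx
    obtain ⟨-, -, d', hd', hdx', hdu'⟩ := hg x' hx'
    rw [← h] at hdu'
    obtain rfl := hout.unique _ h1 d hd d' hd' hdu hdu'
    cases d <;> simp only [OnDiag] at hdx hdx' <;> omega
  -- A diagonal descending to the right through this corner would meet the inner grid only there,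
  -- but exactness demands two points.
  have hg₁ : g x₁ = x₁ - η := by
    obtain ⟨h1 | h1, -, d, hd, hdx, hdu⟩ := hg x₁ hx₁.1
    · exact h1
    exfalso
    obtain ⟨r, hr, hdr, hne⟩ := hin.exists_ne hd (x₁, y₁)
    have h2 := hdr.lt_or_lt hdx hne
    obtain ⟨-, ⟨hr1, hr2⟩, -⟩ := mem_frame.1 hr
    have := hx₁.2 hr1
    have := hy₁.2 hr2
    rw [h1] at hdu
    cases d <;> simp only [OnDiag] at hdr hdx hdu <;> omega
  have hg₂ : g x₂ = x₂ + η := by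
    obtain ⟨h1 | h1, -, d, hd, hdx, hdu⟩ := hg x₂ hx₂.1
    swap
    · exact h1
    exfalso
    obtain ⟨r, hr, hdr, hne⟩ := hin.exists_ne hd (x₂, y₁)
    have h2 := hdr.lt_or_lt hdx hne
    obtain ⟨-, ⟨hr1, hr2⟩, -⟩ := mem_frame.1 hr
    have := hx₂.2 hr1
    have := hy₁.2 hr2
    rw [h1] at hdu
    cases d <;> simp only [OnDiag] at hdr hdx hdu <;> omega
  -- The extreme columns go to the extreme outer columns, so by injectivity all other columns stay
  -- inside `peel X`.
  have e₀ : g x₁ = x₀ := eq_of_mem_of_lt_peel hx₀ hx₁ (hgX _ hx₁.1) (by omega)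
  have e₃ : g x₂ = x₃ := eq_of_mem_of_peel_lt hx₃ hx₂ (hgX _ hx₂.1) (by omega)
  obtain ⟨c, hc, hc2⟩ := exists_center hsymm hodd
  obtain ⟨l, hl, hlX⟩ := exists_progression (x₂ := x₂) (g := g) hηpos hx₁ hsymm hc hc2
    (fun x hx hx1 hx2 => by
      refine (mem_peel_iff hx₀ hx₃).2 ⟨hgX x hx, fun h => hx1 ?_, fun h => hx2 ?_⟩
      · exact hinj hx hx₁.1 (h.trans e₀.symm)
      · exact hinj hx hx₂.1 (h.trans e₃.symm))
    hinj (fun x hx => (hg x hx).1)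
  have hcard : 2 * l + 1 ≤ (peel X).card := by
    have hsub : (Icc (-(l : ℤ)) l).image (fun i => c + i * η) ⊆ peel X := by
      intro x hx
      obtain ⟨i, hi, rfl⟩ := mem_image.1 hx
      rw [mem_Icc] at hi
      have h1 := hlX i.natAbs (by omega)
      rcases Int.natAbs_eq i with h | h
      · convert hsymm _ h1 using 1
        rw [← h, ← hc2]; ring
      · convert h1 using 1
        have : (i.natAbs : ℤ) = -i := by omega
        rw [this]; ring
    have := card_le_card hsub
    rw [card_image_of_injective _ fun i j h =>
      mul_right_cancel₀ hηpos.ne' (add_left_cancel h), Int.card_Icc] at this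
    omega
  have hw2 : x₂ - x₁ = 2 * (l * η) := by linarith
  have hl1 : 1 ≤ (l : ℤ) := by
    by_contra h
    have : (l : ℤ) = 0 := by omega
    rw [this] at hw2
    omega
  have hlη : η ≤ l * η := by nlinarith
  have hcard' : 2 * (l : ℤ) + 1 ≤ (peel X).card := by exact_mod_cast hcard
  refine hasDiagonals_of_margin hx₁ hx₂ hy₁ hy₂ hw hS hηpos (by omega) (by omega) (by omega)
    (by omega) (by omega) ?_
  nlinarith

end Outer

/-! ### Optimizing the layer bounds against G -/

theorem le_G_of_twelve_mul_le {m k : ℕ} (h : 12 * k ≤ m ^ 2) : k ≤ G m := by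
  unfold G
  split_ifs <;> omega

/-- Odd squares are 1 or 9 modulo 12, and for odd `m` residue 9 occurs exactly where `G` has its
extra 1. -/
theorem le_G_of_odd {m k : ℕ} (hm : m % 2 = 1) (h : 12 * k ≤ m ^ 2 + 3) : k ≤ G m := by
  have h1 : m ^ 2 % 12 = (m % 12) ^ 2 % 12 := Nat.pow_mod m 2 12
  have h2 : m % 12 = 1 ∨ m % 12 = 3 ∨ m % 12 = 5 ∨ m % 12 = 7 ∨ m % 12 = 9 ∨ m % 12 = 11 := by
    omega
  unfold G
  rcases h2 with h2 | h2 | h2 | h2 | h2 | h2 <;> rw [h2] at h1 <;> norm_num at h1 <;>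
    split_ifs <;> omega

/-- Even squares are 0 or 4 modulo 12, so an integer above `m ^ 2 / 12` gives `12 * k ≥ m ^ 2 + 8`,
leaving at most 4 for `2 * Q`. Where `G` is raised, `k` is too large. -/
theorem of_G_lt_of_even {m k Q : ℕ} (hm : m % 2 = 0) (h : 12 * k + 2 * Q ≤ m ^ 2 + 12)
    (hk : G m < k) : m % 12 ≠ 6 ∧ m ≠ 10 ∧ Q ≤ 2 ∧ (Q = 2 → 12 * k = m ^ 2 + 8) := by
  have h1 : m ^ 2 % 12 = (m % 12) ^ 2 % 12 := Nat.pow_mod m 2 12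
  have h2 : m % 12 = 0 ∨ m % 12 = 2 ∨ m % 12 = 4 ∨ m % 12 = 6 ∨ m % 12 = 8 ∨ m % 12 = 10 := by
    omega
  have h4 : m ^ 2 % 12 = 0 ∨ m ^ 2 % 12 = 4 := by
    rcases h2 with h2 | h2 | h2 | h2 | h2 | h2 <;> rw [h2] at h1 <;> norm_num at h1 <;> omega
  unfold G at hk
  split_ifs at hk with h5
  · exfalso; omega
  · push Not at h5
    refine ⟨h5.2.1, h5.2.2.2, ?_, ?_⟩ <;> omega

theorem abs_le_one_of_sq_add_sq_le {x y : ℤ} (h : x ^ 2 + y ^ 2 + (x + y) ^ 2 ≤ 2) :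
    -1 ≤ x ∧ x ≤ 1 := by
  have hx : x ^ 2 ≤ 2 := by linarith [sq_nonneg y, sq_nonneg (x + y)]
  constructor <;> nlinarith

/-- The layer bounds suffice, except in some cases in which one of them is sharp and the grid left
over is nearly a square. -/
theorem exists_sharp_layer_of_G_lt {a b N k : ℕ}
    (hlayer : ∀ i, k ≤ 2 * i * N + (a - 2 * i) * (b - 2 * i)) (ha : k ≤ a * N) (hb : k ≤ b * N)
    (hk : G (a + b + N) < k) :
    ∃ I, 1 ≤ I ∧ 2 * I ≤ a ∧ 2 * I ≤ b ∧ k = 2 * I * N + (a - 2 * I) * (b - 2 * I) ∧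
      N + 4 * I = a + b + 2 ∧ a ≤ b + 1 ∧ b ≤ a + 1 ∧ (a = b → Odd a ∧ 2 ≤ I) := by
  have hsmall : ∀ u v w : ℕ, u + v ≤ w → 12 * (u * v) ≤ (u + v + w) ^ 2 := by
    intro u v w h
    have h1 : (2 * (u + v)) ^ 2 ≤ (u + v + w) ^ 2 := Nat.pow_le_pow_left (by omega) 2
    zify at h1 ⊢
    nlinarith [sq_nonneg ((u : ℤ) - v), mul_nonneg (Int.natCast_nonneg u) (Int.natCast_nonneg v)]
  -- The strict triangle inequalities for `a`, `b`, `N` ensure that the near-optimal number of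
  -- layers fits into the grid.
  have h₁ : ¬a + b ≤ N := fun h => by
    have h2 := hlayer 0
    have h3 := hsmall a b N h
    simp only [mul_zero, zero_mul, zero_add, Nat.sub_zero] at h2
    exact absurd (le_G_of_twelve_mul_le (by omega)) (not_le.2 hk)
  have h₂ : ¬a + N ≤ b := fun h => by
    have h3 := hsmall a N b h
    rw [add_right_comm a N b] at h3
    exact absurd (le_G_of_twelve_mul_le (by omega)) (not_le.2 hk)
  have h₃ : ¬b + N ≤ a := fun h => by
    have h3 := hsmall b N a h
    rw [show b + N + a = a + b + N by ring] at h3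
    exact absurd (le_G_of_twelve_mul_le (by omega)) (not_le.2 hk)
  obtain ⟨Q, hQ⟩ : ∃ Q : ℕ, (Q : ℤ) = ((a : ℤ) - b) ^ 2 + ((b : ℤ) - N) ^ 2 + ((a : ℤ) - N) ^ 2 :=
    ⟨_, Int.toNat_of_nonneg (by positivity)⟩
  obtain ⟨τ, hτ⟩ : ∃ τ, a + b = N + τ := ⟨a + b - N, by omega⟩
  -- Completing squares: the bound is optimal at `4 * i = τ`, and `Q` measures the deviation from `a
  -- = b = N`.
  have hident : ∀ i, 2 * i ≤ a → 2 * i ≤ b →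
      12 * ((2 * i * N + (a - 2 * i) * (b - 2 * i) : ℕ) : ℤ) + 2 * Q =
        ((a + b + N : ℕ) : ℤ) ^ 2 + 3 * (4 * i - τ) ^ 2 := by
    intro i hia hib
    push_cast [Nat.cast_sub hia, Nat.cast_sub hib]
    have : (τ : ℤ) = a + b - N := by omega
    rw [hQ, this]
    ring
  have hbound : ∀ i, 2 * i ≤ a → 2 * i ≤ b →
      12 * (k : ℤ) + 2 * Q ≤ ((a + b + N : ℕ) : ℤ) ^ 2 + 3 * (4 * i - τ) ^ 2 := by
    intro i hia hib
    rw [← hident i hia hib]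
    have : (k : ℤ) ≤ (2 * i * N + (a - 2 * i) * (b - 2 * i) : ℕ) := by exact_mod_cast hlayer i
    linarith
  obtain ⟨i, hi | hi | hi | hi⟩ : ∃ i, τ = 4 * i ∨ τ = 4 * i + 1 ∨ τ = 4 * i + 2 ∨ τ = 4 * i + 3 :=
    ⟨τ / 4, by omega⟩
  · have h := hbound i (by omega) (by omega)
    rw [show (4 * (i : ℤ) - τ) = 0 by omega] at h
    exact absurd (le_G_of_twelve_mul_le (by zify; push_cast at h; linarith)) (not_le.2 hk)
  · have h := hbound i (by omega) (by omega)
    rw [show (4 * (i : ℤ) - τ) = -1 by omega] at h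
    exact absurd (le_G_of_odd (by omega) (by zify; push_cast at h; linarith)) (not_le.2 hk)
  · have h := hbound (i + 1) (by omega) (by omega)
    rw [show (4 * ((i + 1 : ℕ) : ℤ) - τ) = 2 by omega] at h
    obtain ⟨g1, g2, g3, g4⟩ := of_G_lt_of_even (Q := Q) (by omega)
      (by zify; push_cast at h; linarith) hk
    have hxy : ((a : ℤ) - b) ^ 2 + ((b : ℤ) - N) ^ 2 + (((a : ℤ) - b) + ((b : ℤ) - N)) ^ 2 ≤ 2 := by
      rw [sub_add_sub_cancel, ← hQ]
      exact_mod_cast g3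
    obtain ⟨hx2, hx1⟩ := abs_le_one_of_sq_add_sq_le hxy
    obtain ⟨hy2, hy1⟩ := abs_le_one_of_sq_add_sq_le (x := (b : ℤ) - N) (y := (a : ℤ) - b)
      (by linarith [add_comm ((a : ℤ) - b) ((b : ℤ) - N)])
    -- `Q` is even, and `Q = 0` would mean `a = b = N = τ`, hence `m ≡ 6 (mod 12)`, which is
    -- excluded.
    have hQ2 : Q = 2 := by
      clear hident hbound hlayer ha hb h hk hsmall g4 hxy
      obtain ⟨x, hx⟩ : ∃ x, x = (a : ℤ) - b := ⟨_, rfl⟩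
      obtain ⟨y, hy⟩ : ∃ y, y = (b : ℤ) - N := ⟨_, rfl⟩
      have hxy : (a : ℤ) - N = x + y := by omega
      rw [hxy, ← hx, ← hy] at hQ
      rw [← hx] at hx1 hx2
      rw [← hy] at hy1 hy2
      interval_cases x <;> interval_cases y <;> norm_num at hQ <;> omega
    have hk2 := g4 hQ2
    have he := hident (i + 1) (by omega) (by omega)
    rw [show (4 * ((i + 1 : ℕ) : ℤ) - τ) = 2 by omega, hQ2] at he
    refine ⟨i + 1, by omega, by omega, by omega, ?_, by omega, by omega, by omega, ?_⟩
    · zify at hk2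
      push_cast at hk2 he ⊢
      linarith
    · rintro rfl
      have hN : N = a + 1 ∨ N + 1 = a := by
        rw [hQ2] at hQ
        have : N ≠ a := by rintro rfl; simp at hQ
        omega
      -- One layer only would mean `a = b = 3`, `N = 4`, that is `m = 10`: the reason for the
      -- sporadic value of `G`.
      exact ⟨Nat.odd_iff.2 (by omega), by omega⟩
  · have h := hbound (i + 1) (by omega) (by omega)
    rw [show (4 * ((i + 1 : ℕ) : ℤ) - τ) = 1 by omega] at h
    exact absurd (le_G_of_odd (by omega) (by zify; push_cast at h; linarith)) (not_le.2 hk)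

/-! ### Queens covered by few diagonals -/

theorem iterate_peel_subset (X : Finset ℤ) (i : ℕ) : peel^[i] X ⊆ X := by
  induction i with
  | zero => exact subset_rfl
  | succ i ih => rw [Function.iterate_succ_apply']; exact (peel_subset _).trans ih

theorem card_le_of_cover {S : Finset (ℤ × ℤ)} {D : Finset (ℤ ⊕ ℤ)}
    (hcov : ∀ q ∈ S, ∃ d ∈ D, OnDiag d q) (f : ℤ × ℤ → ℤ) {X : Finset ℤ}
    (hf : ∀ q ∈ S, f q ∈ X) (hinj : ∀ d, ∀ q r, OnDiag d q → OnDiag d r → f q = f r → q = r) :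
    S.card ≤ X.card * D.card := by
  calc S.card ≤ ∑ d ∈ D, (S.filter (OnDiag d)).card := card_le_sum_card_filter_onDiag hcov
    _ ≤ ∑ d ∈ D, X.card := by
        refine sum_le_sum fun d _ => card_le_card_of_injOn f ?_ ?_
        · intro q hq
          exact hf q (mem_filter.1 hq).1
        · intro q hq r hr h
          exact hinj d q r (mem_filter.1 hq).2 (mem_filter.1 hr).2 h
    _ = X.card * D.card := by rw [sum_const, smul_eq_mul, mul_comm]

/-- The diagonals of many queens that are covered by few diagonals are long. -/
theorem hasDiagonals_of_cover {S : Finset (ℤ × ℤ)} {n : ℤ} {N : ℕ} {D : Finset (ℤ ⊕ ℤ)}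
    (hS : ∀ q ∈ S, 0 ≤ q.1 ∧ q.1 < n ∧ 0 ≤ q.2 ∧ q.2 < n)
    (hD : D.card ≤ N) (hcov : ∀ q ∈ S, ∃ d ∈ D, OnDiag d q) {X Y : Finset ℤ}
    (hX : X = S.image Prod.fst) (hY : Y = S.image Prod.snd)
    (hk : G (X.card + Y.card + N) < S.card) :
    HasDiagonals S n (4 * X.card + 2) (n * (N + 1)) := by
  have hXS : ∀ q ∈ S, q.1 ∈ X := fun q hq => hX ▸ mem_image_of_mem _ hq
  have hYS : ∀ q ∈ S, q.2 ∈ Y := fun q hq => hY ▸ mem_image_of_mem _ hq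
  have hXn : ∀ x ∈ X, 0 ≤ x ∧ x < n := by
    intro x hx
    rw [hX] at hx
    obtain ⟨q, hq, rfl⟩ := mem_image.1 hx
    exact ⟨(hS q hq).1, (hS q hq).2.1⟩
  have hYn : ∀ y ∈ Y, 0 ≤ y ∧ y < n := by
    intro y hy
    rw [hY] at hy
    obtain ⟨q, hq, rfl⟩ := mem_image.1 hy
    exact (hS q hq).2.2
  have hres : restrict S X Y = S := by
    ext q
    rw [mem_restrict]
    exact ⟨fun h => h.1, fun h => ⟨h, hXS q h, hYS q h⟩⟩
  obtain ⟨I, hI, hIa, hIb, hkI, hN, hab, hba, hsq⟩ :=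
    exists_sharp_layer_of_G_lt (a := X.card) (b := Y.card) (N := N) (k := S.card)
    (fun i => by
      have h1 := card_restrict_le_of_cover hcov i X Y
      rw [hres] at h1
      have h2 : 2 * i * D.card ≤ 2 * i * N := Nat.mul_le_mul_left _ hD
      omega)
    ((card_le_of_cover hcov Prod.fst hXS fun d q r hq hr h => by
      refine Prod.ext h ?_
      cases d <;> simp only [OnDiag] at hq hr <;> omega).trans (Nat.mul_le_mul_left _ hD))
    ((card_le_of_cover hcov Prod.snd hYS fun d q r hq hr h => by
      refine Prod.ext ?_ h
      cases d <;> simp only [OnDiag] at hq hr <;> omega).trans (Nat.mul_le_mul_left _ hD)) hk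
  obtain rfl : N = D.card := by
    have h1 := card_restrict_le_of_cover hcov I X Y
    rw [hres] at h1
    refine le_antisymm ?_ hD
    have h2 : 2 * I * N ≤ 2 * I * D.card := by omega
    exact Nat.le_of_mul_le_mul_left h2 (by omega)
  obtain ⟨hframe, hinner⟩ := card_frame_eq_of_card_restrict_eq hcov I X Y (by rw [hres, hkI])
  obtain ⟨J, rfl⟩ : ∃ J, I = J + 1 := ⟨I - 1, by omega⟩
  have hcX := card_iterate_peel X J
  have hcY := card_iterate_peel Y J
  -- The last peeled layer is full too: for an inner `u × v` grid, `N = u + v + 2` and `2 * N + u *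
  -- v = (u + 2) * (v + 2)`.
  have hfull : (restrict S (peel^[J] X) (peel^[J] Y)).card =
      (peel^[J] X).card * (peel^[J] Y).card := by
    rw [card_restrict, hframe J (by omega), ← Function.iterate_succ_apply' peel J,
      ← Function.iterate_succ_apply' peel J, Nat.succ_eq_add_one, hinner, hcX, hcY]
    obtain ⟨u, hu⟩ := Nat.exists_eq_add_of_le hIa
    obtain ⟨v, hv⟩ := Nat.exists_eq_add_of_le hIb
    have e1 : X.card - 2 * (J + 1) = u := by omega
    have e2 : Y.card - 2 * (J + 1) = v := by omega
    have e3 : X.card - 2 * J = u + 2 := by omega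
    have e4 : Y.card - 2 * J = v + 2 := by omega
    have e5 : D.card = u + v + 2 := by omega
    rw [e1, e2, e3, e4, e5]
    ring
  have hgrid : ∀ x ∈ peel^[J] X, ∀ y ∈ peel^[J] Y, (x, y) ∈ S := fun x hx y hy =>
    mem_of_card_restrict hfull hx hy
  have hX1 : 1 < (peel^[J] X).card := by omega
  have hY1 : 1 < (peel^[J] Y).card := by omega
  obtain ⟨x₁, hx₁⟩ := exists_isLeast (card_pos.1 (zero_lt_one.trans hX1))
  obtain ⟨x₂, hx₂⟩ := exists_isGreatest (card_pos.1 (zero_lt_one.trans hX1))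
  obtain ⟨y₁, hy₁⟩ := exists_isLeast (card_pos.1 (zero_lt_one.trans hY1))
  obtain ⟨y₂, hy₂⟩ := exists_isGreatest (card_pos.1 (zero_lt_one.trans hY1))
  have hltX : x₁ < x₂ := by
    obtain ⟨u, hu, v, hv, huv⟩ := one_lt_card.1 hX1
    have := hx₁.2 hu
    have := hx₁.2 hv
    have := hx₂.2 hu
    have := hx₂.2 hv
    omega
  have hltY : y₁ < y₂ := by
    obtain ⟨u, hu, v, hv, huv⟩ := one_lt_card.1 hY1
    have := hy₁.2 hu
    have := hy₁.2 hv
    have := hy₂.2 hu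
    have := hy₂.2 hv
    omega
  obtain ⟨hw, hcard⟩ := width_eq_height_of_cover hx₁ hx₂ hy₁ hy₂ hltX hltY
    (fun x hx y hy => hcov _ (hgrid x hx y hy)) (by omega) (by omega) (by omega)
  obtain ⟨hodd, hJ⟩ := hsq (by omega)
  obtain ⟨l, rfl⟩ : ∃ l, J = l + 1 := ⟨J - 1, by omega⟩
  have hin := exactCover_of_card_frame hcov (hframe (l + 1) (by omega))
  have hout := exactCover_of_card_frame hcov (hframe l (by omega))
  have hX0 : 0 < (peel^[l] X).card := by rw [card_iterate_peel]; omega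
  have hY0 : 0 < (peel^[l] Y).card := by rw [card_iterate_peel]; omega
  obtain ⟨x₀, hx₀⟩ := exists_isLeast (card_pos.1 hX0)
  obtain ⟨x₃, hx₃⟩ := exists_isGreatest (card_pos.1 hX0)
  obtain ⟨y₀, hy₀⟩ := exists_isLeast (card_pos.1 hY0)
  obtain ⟨y₃, hy₃⟩ := exists_isGreatest (card_pos.1 hY0)
  have hoddJ : Odd (peel^[l + 1] X).card := by
    rw [hcX, Nat.odd_iff]
    have := Nat.odd_iff.1 hodd
    omega
  rw [Function.iterate_succ_apply' peel l] at *
  rw [Function.iterate_succ_apply' peel l] at *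
  obtain ⟨P, Q, h1, h2, h3, h4⟩ := hasDiagonals_of_exactCover (n := n) hx₀ hx₃ hy₀ hy₃ hx₁ hx₂ hy₁
    hy₂ hltX hw hgrid hoddJ hin hout (hXn _ (iterate_peel_subset X l hx₀.1)).1
    (hXn _ (iterate_peel_subset X l hx₃.1)).2 (hYn _ (iterate_peel_subset Y l hy₀.1)).1
    (hYn _ (iterate_peel_subset Y l hy₃.1)).2
  refine ⟨P, Q, h1, h2, by omega, ?_⟩
  have e : (D.card : ℤ) + 1 = 2 * ((peel (peel^[l] X)).card : ℤ) - 1 := by omega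
  rw [e]
  exact h4

/-- The diagonals of many queens in few rows and columns are long. -/
theorem hasDiagonals_of_G_lt {S : Finset (ℤ × ℤ)} {n : ℤ} {N : ℕ}
    (hS : ∀ q ∈ S, 0 ≤ q.1 ∧ q.1 < n ∧ 0 ≤ q.2 ∧ q.2 < n)
    (hk : G ((S.image Prod.fst).card + (S.image Prod.snd).card + N) < S.card) :
    HasDiagonals S n (4 * (S.image Prod.fst).card + 2 * N + 2) (n * (N + 1)) := by
  rcases exists_matching_or_cover (S.image fun q => (q.2 - q.1, q.1 + q.2)) N with
    ⟨M, hM, hcard, hinj₁, hinj₂⟩ | ⟨A, B, hAB, hcov⟩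
  · have hmem : ∀ e ∈ M, ∃ q ∈ S, q.2 - q.1 = e.1 ∧ q.1 + q.2 = e.2 := by
      intro e he
      obtain ⟨q, hq, rfl⟩ := mem_image.1 (hM he)
      exact ⟨q, hq, rfl, rfl⟩
    refine ⟨M.image Prod.fst, M.image Prod.snd, ?_, ?_, ?_, ?_⟩
    · intro d hd
      obtain ⟨e, he, rfl⟩ := mem_image.1 hd
      obtain ⟨q, hq, h, -⟩ := hmem e he
      exact ⟨q, hq, h⟩
    · intro d hd
      obtain ⟨e, he, rfl⟩ := mem_image.1 hd
      obtain ⟨q, hq, -, h⟩ := hmem e he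
      exact ⟨q, hq, h⟩
    · rw [card_image_of_injOn hinj₁, card_image_of_injOn hinj₂]
      omega
    · rw [sum_image hinj₁, sum_image hinj₂, ← sum_add_distrib]
      calc n * (N + 1) = ∑ e ∈ M, n := by
            rw [sum_const, hcard, nsmul_eq_mul]; push_cast; ring
        _ ≤ _ := by
            apply sum_le_sum
            intro e he
            obtain ⟨q, hq, h1, h2⟩ := hmem e he
            obtain ⟨b1, b2, b3, b4⟩ := hS q hq
            have := length_add_length_ge (n := n) (x := q.1) (y := q.2) (e := 0) b1 (by omega) b3
              (by omega)
            rw [h1, h2] at this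
            linarith
  · have hD : (A.disjSum B).card ≤ N := by rw [card_disjSum]; exact hAB
    have hcov' : ∀ q ∈ S, ∃ d ∈ A.disjSum B, OnDiag d q := by
      intro q hq
      rcases hcov _ (mem_image_of_mem _ hq) with h | h
      · exact ⟨_, inl_mem_disjSum.2 h, rfl⟩
      · exact ⟨_, inr_mem_disjSum.2 h, rfl⟩
    obtain ⟨P, Q, h1, h2, h3, h4⟩ := hasDiagonals_of_cover hS hD hcov' rfl rfl hk
    exact ⟨P, Q, h1, h2, by omega, h4⟩

/-! ### Lengths of lines on the board -/

section Length

variable {n : ℕ}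

theorem le_length_row (y : Fin n) : n ≤ (Line.row y).length := by
  classical
  have h : (univ.image fun x : Fin n => (x, y)).card = n := by
    rw [card_image_of_injective _ (fun a b h => (Prod.ext_iff.1 h).1), card_univ, Fintype.card_fin]
  rw [Line.length]
  refine h.ge.trans (card_le_card ?_)
  intro q hq
  obtain ⟨x, -, rfl⟩ := mem_image.1 hq
  exact mem_filter.2 ⟨mem_univ _, rfl⟩

theorem le_length_col (x : Fin n) : n ≤ (Line.col x).length := by
  classical
  have h : (univ.image fun y : Fin n => (x, y)).card = n := by
    rw [card_image_of_injective _ (fun a b h => (Prod.ext_iff.1 h).2), card_univ, Fintype.card_fin]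
  rw [Line.length]
  refine h.ge.trans (card_le_card ?_)
  intro q hq
  obtain ⟨y, -, rfl⟩ := mem_image.1 hq
  exact mem_filter.2 ⟨mem_univ _, rfl⟩

theorem card_le_length {L : Line n} {I : Finset ℤ}
    (h : ∀ x ∈ I, ∃ q : Square n, L.Contains q ∧ ((q.1 : ℕ) : ℤ) = x) : I.card ≤ L.length := by
  classical
  rw [Line.length]
  refine le_trans (card_le_card ?_) (card_image_le (f := fun q : Square n => ((q.1 : ℕ) : ℤ)))
  intro x hx
  obtain ⟨q, hq, rfl⟩ := h x hx
  exact mem_image.2 ⟨q, mem_filter.2 ⟨mem_univ _, hq⟩, rfl⟩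

theorem le_length_posDiag (d : ℤ) : (n : ℤ) - |d| ≤ (Line.posDiag d : Line n).length := by
  have h := card_le_length (L := (Line.posDiag d : Line n)) (I := Ico (max 0 (-d)) (min n (n - d)))
    (by
      intro x hx
      rw [mem_Ico] at hx
      refine ⟨(⟨x.toNat, by omega⟩, ⟨(x + d).toNat, by omega⟩), ?_, ?_⟩
      · simp only [Line.Contains]; omega
      · simp only; omega)
  rw [Int.card_Ico] at h
  rcases abs_cases d with h' | h' <;> omega

theorem le_length_negDiag (s : ℤ) :
    (n : ℤ) - |s - (n - 1)| ≤ (Line.negDiag s : Line n).length := by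
  have h := card_le_length (L := (Line.negDiag s : Line n))
    (I := Icc (max 0 (s - (n - 1))) (min (n - 1) s))
    (by
      intro x hx
      rw [mem_Icc] at hx
      refine ⟨(⟨x.toNat, by omega⟩, ⟨(s - x).toNat, by omega⟩), ?_, ?_⟩
      · simp only [Line.Contains]; omega
      · simp only; omega)
  rw [Int.card_Icc] at h
  rcases abs_cases (s - (n - 1)) with h' | h' <;> omega

end Length

/-- The rows and columns that contain a queen. -/
theorem exists_rows_and_columns {n : ℕ} (S : Finset (Square n)) :
    ∃ T : Finset (Line n), (∀ L ∈ T, ∃ q ∈ S, L.Contains q) ∧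
      T.card = (S.image Prod.fst).card + (S.image Prod.snd).card ∧ (∀ L ∈ T, n ≤ L.length) ∧
      ∀ d, Line.posDiag d ∉ T ∧ Line.negDiag d ∉ T := by
  classical
  refine ⟨(S.image Prod.fst).image Line.col ∪ (S.image Prod.snd).image Line.row, ?_, ?_, ?_, ?_⟩
  · intro L hL
    simp only [mem_union, mem_image] at hL
    rcases hL with ⟨x, ⟨q, hq, rfl⟩, rfl⟩ | ⟨y, ⟨q, hq, rfl⟩, rfl⟩
    exacts [⟨q, hq, rfl⟩, ⟨q, hq, rfl⟩]
  · have hcol : Function.Injective (Line.col (n := n)) := fun a b h => by injection h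
    have hrow : Function.Injective (Line.row (n := n)) := fun a b h => by injection h
    rw [card_union_of_disjoint, card_image_of_injective _ hcol, card_image_of_injective _ hrow]
    rw [disjoint_left]
    intro L hL hL'
    obtain ⟨x, -, rfl⟩ := mem_image.1 hL
    obtain ⟨y, -, h⟩ := mem_image.1 hL'
    cases h
  · intro L hL
    simp only [mem_union, mem_image] at hL
    rcases hL with ⟨x, -, rfl⟩ | ⟨y, -, rfl⟩
    exacts [le_length_col x, le_length_row y]
  · intro d
    simp

end Queens

/-! ### Conclusion -/

theorem proposition2 :
    ∃ K : ℕ, ∀ n m k : ℕ, 0 < m → Queens.G m < k →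
      ∀ S : Finset (Queens.Square n), S.card = k →
        ∃ T : Finset (Queens.Line n),
          (∀ L ∈ T, ∃ q ∈ S, L.Contains q) ∧
          T.card ≤ K * m ∧
          n * (m + 1) ≤ ∑ L ∈ T, L.length := by
  classical
  -- With a columns, b rows and N = m - a - b, at most (a + b) + (4a + 2N + 2) ≤ 5m + 2 ≤ 7m lines
  -- are used.
  refine ⟨7, fun n m k hm hk S hS => ?_⟩
  obtain ⟨T, hT, hTcard, hTlen, hTdiag⟩ := Queens.exists_rows_and_columns S
  by_cases hlarge : m + 1 ≤ T.card
  · obtain ⟨T', hT', hc⟩ := Finset.exists_subset_card_eq hlarge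
    refine ⟨T', fun L hL => hT L (hT' hL), by omega, ?_⟩
    calc n * (m + 1) = ∑ L ∈ T', n := by rw [Finset.sum_const, hc, smul_eq_mul, mul_comm]
      _ ≤ _ := Finset.sum_le_sum fun L hL => hTlen L (hT' hL)
  let e : Queens.Square n → ℤ × ℤ := fun q => (((q.1 : ℕ) : ℤ), ((q.2 : ℕ) : ℤ))
  have he : Function.Injective e := by
    intro q r h
    simp only [e, Prod.mk.injEq, Nat.cast_inj] at h
    exact Prod.ext (Fin.ext h.1) (Fin.ext h.2)
  have hcast : Function.Injective fun x : Fin n => ((x : ℕ) : ℤ) := fun x y h =>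
    Fin.ext (Nat.cast_injective h)
  have hfst : ((S.image e).image Prod.fst).card = (S.image Prod.fst).card := by
    rw [Finset.image_image, ← Finset.card_image_of_injective (S.image Prod.fst) hcast,
      Finset.image_image]
    rfl
  have hsnd : ((S.image e).image Prod.snd).card = (S.image Prod.snd).card := by
    rw [Finset.image_image, ← Finset.card_image_of_injective (S.image Prod.snd) hcast,
      Finset.image_image]
    rfl
  obtain ⟨N, hN⟩ : ∃ N, m = T.card + N := ⟨m - T.card, by omega⟩
  obtain ⟨P, Q, hP, hQ, hcard, hlen⟩ := Queens.hasDiagonals_of_G_lt (S := S.image e) (n := n)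
    (N := N)
    (by
      intro q hq
      obtain ⟨r, -, rfl⟩ := Finset.mem_image.1 hq
      simp only [e]
      omega)
    (by rw [hfst, hsnd, ← hTcard, ← hN, Finset.card_image_of_injective _ he, hS]; exact hk)
  rw [hfst] at hcard
  refine ⟨T ∪ (P.image Queens.Line.posDiag ∪ Q.image Queens.Line.negDiag), ?_, ?_, ?_⟩
  · intro L hL
    simp only [Finset.mem_union, Finset.mem_image] at hL
    rcases hL with hL | ⟨d, hd, rfl⟩ | ⟨d, hd, rfl⟩
    · exact hT L hL
    · obtain ⟨q, hq, h⟩ := hP d hd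
      obtain ⟨r, hr, rfl⟩ := Finset.mem_image.1 hq
      exact ⟨r, hr, h⟩
    · obtain ⟨q, hq, h⟩ := hQ d hd
      obtain ⟨r, hr, rfl⟩ := Finset.mem_image.1 hq
      exact ⟨r, hr, h⟩
  · have h1 := Finset.card_union_le T (P.image Queens.Line.posDiag ∪ Q.image Queens.Line.negDiag)
    have h2 := Finset.card_union_le (P.image (Queens.Line.posDiag (n := n)))
      (Q.image Queens.Line.negDiag)
    have h3 : (P.image (Queens.Line.posDiag (n := n))).card ≤ P.card := Finset.card_image_le
    have h4 : (Q.image (Queens.Line.negDiag (n := n))).card ≤ Q.card := Finset.card_image_le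
    omega
  · have hd1 : Disjoint T (P.image Queens.Line.posDiag ∪ Q.image Queens.Line.negDiag) := by
      rw [Finset.disjoint_left]
      intro L hL hL'
      simp only [Finset.mem_union, Finset.mem_image] at hL'
      rcases hL' with ⟨d, -, rfl⟩ | ⟨d, -, rfl⟩
      exacts [(hTdiag d).1 hL, (hTdiag d).2 hL]
    have hd2 : Disjoint (P.image (Queens.Line.posDiag (n := n)))
        (Q.image Queens.Line.negDiag) := by
      rw [Finset.disjoint_left]
      intro L hL hL'
      obtain ⟨d, -, rfl⟩ := Finset.mem_image.1 hL
      obtain ⟨s, -, h⟩ := Finset.mem_image.1 hL'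
      cases h
    rw [Finset.sum_union hd1, Finset.sum_union hd2,
      Finset.sum_image (fun a _ b _ h => by injection h),
      Finset.sum_image (fun a _ b _ h => by injection h)]
    have h1 : T.card * n ≤ ∑ L ∈ T, L.length := by
      rw [← smul_eq_mul, ← Finset.sum_const]
      exact Finset.sum_le_sum hTlen
    have h2 : ∑ d ∈ P, ((n : ℤ) - |d|) ≤
        ∑ d ∈ P, ((Queens.Line.posDiag d : Queens.Line n).length : ℤ) :=
      Finset.sum_le_sum fun d _ => Queens.le_length_posDiag d
    have h3 : ∑ s ∈ Q, ((n : ℤ) - |s - (n - 1)|) ≤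
        ∑ s ∈ Q, ((Queens.Line.negDiag s : Queens.Line n).length : ℤ) :=
      Finset.sum_le_sum fun s _ => Queens.le_length_negDiag s
    zify at h1 ⊢
    rw [hN]
    push_cast
    linarith
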